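/- Let $k\ge 2$ be a fixed integer. For a $k$-uniform hypergraph $H=([n],\mathcal E)$ with $k\mid n$ and $m$ edges, let $p=m/\binom nk$ be its density, and for $X\subseteq[n]$ with $|X|\le k$ let $N_H(X)=\{Y\subseteq[n]: |Y|=k-|X|,\ X\cup Y\in\mathcal E\}$ and $d_H(X)=|N_H(X)|$. Put $k_X=\lfloor k/2\rfloor$ and $k_Y=\lceil k/2\rceil$. Suppose that, for a parameter $\epsilon=\epsilon(n)$, $H$ satisfies: - $R_a$: $d_H(S)\ge\left\lceil(1-\epsilon)\binom{n-k_X}{k_Y}p\right\rceil$ for all $S\subseteq[n]$ with $|S|=k_X$; - $R_b$: $d_H(S)\ge\left\lceil(1-\epsilon)\binom{n-k_Y}{k_X}p\right\rceil$ for all $S\subseteq[n]$ with $|S|=k_Y$; - $R_c$: $d_H(S)\le\left\lceil(1+\epsilon)\binom{n-k_X-1}{k_Y-1}p\right\rceil$ for all $S\subseteq[n]$ with $|S|=k_X+1$; - $R_d$: $d_H(S)\le\left\lceil(1+\epsilon)\binom{n-k_Y-1}{k_X-1}p\right\rceil$ for all $S\subseteq[n]$ with $|S|=k_Y+1$; -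 $R_e$: $|N_H(S_1)\cap N_H(S_2)|\le\left\lfloor(1+\epsilon)\binom{n-2k_X}{k_Y}p^2\right\rfloor$ for all disjoint $S_1,S_2\subseteq[n]$ with $|S_1|=|S_2|=k_X$; - $R_f$: $|N_H(S_1)\cap N_H(S_2)|\le\left\lfloor(1+\epsilon)\binom{n-2k_Y}{k_X}p^2\right\rfloor$ for all disjoint $S_1,S_2\subseteq[n]$ with $|S_1|=|S_2|=k_Y$. Suppose further that $1\gg\epsilon\gg\log^5 n/(n^{1/2}p^2)$, where $a\gg b$ means $a/b\to\infty$ as $n\to\infty$ ($n$ running through multiples of $k$; $H$, $m$, $p$ and $\epsilon$ depend on $n$). Then, for all sufficiently large $n$, $H$ contains a collection of at least $(1-4\epsilon^{1/3})\,m/\nu_k$ pairwise edge-disjoint perfect matchings, where $\nu_k=n/k$ and a perfect matching is a set of edges of $H$ that partitions $[n]$. -/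

import Mathlib

open Filter Topology

/-- A `k`-uniform hypergraph on the finite vertex set `V`: a family of distinct `k`-element
subsets of `V`, called edges. -/
structure UniformHypergraph (V : Type*) [Fintype V] [DecidableEq V] (k : ℕ) where
  /-- The set of edges. -/
  edges : Finset (Finset V)
  /-- Every edge has exactly `k` vertices. -/
  sized : (edges : Set (Finset V)).Sized k

namespace UniformHypergraph

variable {V : Type*} [Fintype V] [DecidableEq V] {k : ℕ}

/-- The number `m` of edges. -/
def numEdges (H : UniformHypergraph V k) : ℕ := H.edges.card

/-- The density `p = m / binom(n, k)`, where `n` is the number of vertices. -/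
noncomputable def density (H : UniformHypergraph V k) : ℝ :=
  (H.numEdges : ℝ) / ((Fintype.card V).choose k : ℝ)

/-- The neighbourhood `N_H(X)` of a set `X` of `a` vertices: the family of all
`(k - a)`-element sets `Y` of vertices such that `X ∪ Y` is an edge. -/
def nbhd (H : UniformHypergraph V k) (X : Finset V) : Finset (Finset V) :=
  (Finset.powersetCard (k - X.card) Finset.univ).filter (fun Y => X ∪ Y ∈ H.edges)

/-- The degree `d_H(X) = |N_H(X)|`. -/
def degree (H : UniformHypergraph V k) (X : Finset V) : ℕ := (H.nbhd X).card

/-- Every `a`-set of vertices has degree at least `⌈(1 - ε) binom(n - a, k - a) p⌉`. -/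
def MinDegreeCond (H : UniformHypergraph V k) (ε : ℝ) (a : ℕ) : Prop :=
  ∀ S : Finset V, S.card = a →
    ⌈(1 - ε) * ((Fintype.card V - a).choose (k - a) : ℝ) * H.density⌉ ≤ (H.degree S : ℤ)

/-- Every `(a + 1)`-set of vertices has degree at most
`⌈(1 + ε) binom(n - a - 1, k - a - 1) p⌉`. -/
def MaxDegreeCond (H : UniformHypergraph V k) (ε : ℝ) (a : ℕ) : Prop :=
  ∀ S : Finset V, S.card = a + 1 →
    (H.degree S : ℤ) ≤
      ⌈(1 + ε) * ((Fintype.card V - a - 1).choose (k - a - 1) : ℝ) * H.density⌉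

/-- Any two disjoint `a`-sets of vertices have at most
`⌊(1 + ε) binom(n - 2a, k - a) p²⌋` common neighbours. -/
def CodegreeCond (H : UniformHypergraph V k) (ε : ℝ) (a : ℕ) : Prop :=
  ∀ S₁ S₂ : Finset V, S₁.card = a → S₂.card = a → Disjoint S₁ S₂ →
    ((H.nbhd S₁ ∩ H.nbhd S₂).card : ℤ) ≤
      ⌊(1 + ε) * ((Fintype.card V - 2 * a).choose (k - a) : ℝ) * H.density ^ 2⌋

/-- The six pseudo-randomness conditions with regularity parameter `ε`, for the splitting
`k = k_X + k_Y` with `k_X = ⌊k / 2⌋` and `k_Y = k - k_X = ⌈k / 2⌉`. -/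
structure IsPseudoRandom (H : UniformHypergraph V k) (ε : ℝ) : Prop where
  /-- Lower bound on the degrees of `k_X`-sets. -/
  Ra : H.MinDegreeCond ε (k / 2)
  /-- Lower bound on the degrees of `k_Y`-sets. -/
  Rb : H.MinDegreeCond ε (k - k / 2)
  /-- Upper bound on the degrees of `(k_X + 1)`-sets. -/
  Rc : H.MaxDegreeCond ε (k / 2)
  /-- Upper bound on the degrees of `(k_Y + 1)`-sets. -/
  Rd : H.MaxDegreeCond ε (k - k / 2)
  /-- Upper bound on the codegrees of disjoint `k_X`-sets. -/
  Re : H.CodegreeCond ε (k / 2)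
  /-- Upper bound on the codegrees of disjoint `k_Y`-sets. -/
  Rf : H.CodegreeCond ε (k - k / 2)

/-- A perfect matching: a set of edges such that every vertex lies in exactly one of them. -/
def IsPerfectMatching (H : UniformHypergraph V k) (M : Finset (Finset V)) : Prop :=
  M ⊆ H.edges ∧ ∀ v : V, ∃! e : Finset V, e ∈ M ∧ v ∈ e

/-- A collection of pairwise edge-disjoint perfect matchings of `H`. -/
def IsPerfectMatchingPacking (H : UniformHypergraph V k)
    (C : Finset (Finset (Finset V))) : Prop :=
  (∀ M ∈ C, H.IsPerfectMatching M) ∧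
    ∀ M₁ ∈ C, ∀ M₂ ∈ C, M₁ ≠ M₂ → Disjoint M₁ M₂

end UniformHypergraph

/-- `a ≫ b`, that is, `a / b → ∞`, for real sequences. -/
def MuchGreater (a b : ℕ → ℝ) : Prop := Tendsto (fun i => a i / b i) atTop atTop

/-! Cut the vertex set into `N = n / k` left blocks of size `⌊k / 2⌋` and `N` right blocks of size
`⌈k / 2⌉`, and move all blocks by a permutation `σ`. The pairs (left block, right block) whose union
is an edge of `H` form a bipartite graph on `N + N` points, and a perfect matching of this graph is
a perfect matching of `H`. The problem thus becomes one of packing perfect matchings in many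
bipartite graphs without using an edge of `H` twice.

For most `σ` the degrees in this graph are at least about `p * N` and the codegrees at most about `p
^ 2 * N`: the counts involved change by at most 2 under a transposition, so they concentrate
(`card_perm_ge_le`, `card_not_isBalancedFor_le`). Degrees and codegrees control the variance of the
degrees into a set, whence at least `(1 - θ) * p * |S| * |T|` edges run between `S` and `T` as soon
as `|S| + |T| ≥ N` (`card_edgesBetween_ge`).

Now draw `r` permutations independently from the good ones. Each edge of `H` occurs in at most `K`
of the resulting graphs, where `K` barely exceeds the expected number (`exists_balanced_sample`).
Give every edge a random colour among `K` in order to decide which of its occurrences survives; each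
graph keeps nearly a `1 / K` share of its edges across every relevant cut (`exists_labelling`). The
surviving graphs are edge-disjoint in `H`. By the Ore–Ryser criterion each contains an `s`-regular
spanning subgraph with `s` close to `p * N / K`, which splits into `s` perfect matchings
(`exists_disjoint_matchings`).

Since `K` is close to `r * N ^ 2 / n.choose k`, the total `r * s` is close to `p * n.choose k / N =
m / N`. All relative errors are multiples of `θ = ε ^ (1 / 3) / 2`, and they add up to less than `8
* θ`. -/

/-- The edges of the bipartite graph `G` between `S` and `T`. -/
def edgesBetween {α β : Type*} [DecidableEq α] [DecidableEq β] (G : Finset (α × β))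
    (S : Finset α) (T : Finset β) : Finset (α × β) :=
  G.filter fun x => x.1 ∈ S ∧ x.2 ∈ T

/-! ### Regular subgraphs of bipartite graphs and their matchings. -/

section Factor

variable {α β : Type*} [Fintype α] [DecidableEq α] [Fintype β] [DecidableEq β]

/-- The bipartite factor theorem of Ore and Ryser, deduced from Hall's theorem. -/
theorem exists_regular_subgraph (G : Finset (α × β)) (r : ℕ)
    (hcard : Fintype.card α = Fintype.card β)
    (h : ∀ (S : Finset α) (T : Finset β),
      r * (S.card + T.card) ≤ r * Fintype.card α + (edgesBetween G S T).card) :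
    ∃ F ⊆ G, (∀ a, (F.filter fun x => x.1 = a).card = r) ∧
      ∀ b, (F.filter fun x => x.2 = b).card = r := by
  classical
  -- The auxiliary Hall problem has `r` copies of each `a` and the edges of `G` on one side, and the
  -- edges and `r` copies of each `b` on the other. A copy of `a` claims an edge at `a`; an edge
  -- either takes its own place (it is rejected) or, when that place is claimed, goes to a copy of
  -- its endpoint in `β`. Claimed edges form the regular subgraph.
  let t : (α × Fin r) ⊕ G → Finset (G ⊕ (β × Fin r)) := fun x =>
    match x with
    | Sum.inl p => Finset.univ.filter fun y => ∃ e : G, y = Sum.inl e ∧ e.1.1 = p.1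
    | Sum.inr e => Finset.univ.filter fun y =>
        y = Sum.inl e ∨ ∃ j : Fin r, y = Sum.inr (e.1.2, j)
  have hall : ∀ s : Finset ((α × Fin r) ⊕ G), s.card ≤ (s.biUnion t).card := by
    intro s
    set U := s.biUnion t with hU
    set S : Finset α := s.toLeft.image Prod.fst with hS
    set Q : Finset G := s.toRight with hQ
    set B : Finset β := Q.image (fun e => e.1.2) with hB
    have h1 : s.toLeft.card ≤ S.card * r := by
      have : s.toLeft ⊆ S ×ˢ (Finset.univ : Finset (Fin r)) := by
        intro x hx
        simp only [Finset.mem_product, Finset.mem_univ, and_true]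
        exact Finset.mem_image_of_mem _ hx
      simpa [Finset.card_product] using Finset.card_le_card this
    have h2 : B.card * r ≤ U.toRight.card := by
      have : B ×ˢ (Finset.univ : Finset (Fin r)) ⊆ U.toRight := by
        rintro ⟨b, j⟩ hx
        simp only [Finset.mem_product, Finset.mem_univ, and_true, hB, Finset.mem_image] at hx
        obtain ⟨e, he, rfl⟩ := hx
        rw [Finset.mem_toRight, hU, Finset.mem_biUnion]
        exact ⟨Sum.inr e, Finset.mem_toRight.1 he, by simp [t]⟩
      simpa [Finset.card_product] using Finset.card_le_card this
    -- Edges of `Q` end in `B`, so they are distinct from the edges between `S` and the complement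
    -- of `B`; both kinds lie in the neighbourhood. The cut condition for `S` and `Bᶜ` then closes
    -- the count.
    have h3 : Q.card + (edgesBetween G S Bᶜ).card ≤ U.toLeft.card := by
      have hd : Disjoint (Q.map (Function.Embedding.subtype _)) (edgesBetween G S Bᶜ) := by
        rw [Finset.disjoint_left]
        intro x hx hx'
        simp only [Finset.mem_map, Function.Embedding.subtype_apply] at hx
        obtain ⟨e, he, rfl⟩ := hx
        simp only [edgesBetween, Finset.mem_filter, Finset.mem_compl] at hx'
        exact hx'.2.2 (Finset.mem_image_of_mem (fun e : G => e.1.2) he)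
      rw [← Finset.card_map (Function.Embedding.subtype _) (s := Q),
        ← Finset.card_union_of_disjoint hd,
        ← Finset.card_map (Function.Embedding.subtype _) (s := U.toLeft)]
      refine Finset.card_le_card fun x hx => ?_
      simp only [Finset.mem_map, Function.Embedding.subtype_apply]
      rcases Finset.mem_union.1 hx with hx | hx
      · simp only [Finset.mem_map, Function.Embedding.subtype_apply] at hx
        obtain ⟨e, he, rfl⟩ := hx
        refine ⟨e, ?_, rfl⟩
        rw [Finset.mem_toLeft, hU, Finset.mem_biUnion]
        exact ⟨Sum.inr e, Finset.mem_toRight.1 he, by simp [t]⟩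
      · simp only [edgesBetween, Finset.mem_filter, hS, Finset.mem_image] at hx
        obtain ⟨hG, ⟨⟨a, i⟩, hp, hpx⟩, -⟩ := hx
        refine ⟨⟨x, hG⟩, ?_, rfl⟩
        rw [Finset.mem_toLeft, hU, Finset.mem_biUnion]
        refine ⟨Sum.inl (a, i), Finset.mem_toLeft.1 hp, ?_⟩
        simp only [t, Finset.mem_filter, Finset.mem_univ, true_and]
        exact ⟨_, rfl, hpx.symm⟩
    have h4 := h S Bᶜ
    have h5 : B.card + Bᶜ.card = Fintype.card β := Finset.card_add_card_compl B
    have h6 := Finset.card_toLeft_add_card_toRight (u := s)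
    have h7 := Finset.card_toLeft_add_card_toRight (u := U)
    rw [hcard, ← h5] at h4
    nlinarith
  obtain ⟨f, hinj, hf⟩ := (Finset.all_card_le_biUnion_card_iff_exists_injective t).1 hall
  -- Both sides have `r * |α| + |G|` elements. Surjectivity is what makes the degrees on the side of
  -- `β` equal to `r`.
  have hbij : Function.Bijective f := by
    rw [Fintype.bijective_iff_injective_and_card]
    refine ⟨hinj, ?_⟩
    simp only [Fintype.card_sum, Fintype.card_prod, hcard]
    ring
  have hfl : ∀ a i, ∃ e : G, f (Sum.inl (a, i)) = Sum.inl e ∧ e.1.1 = a := by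
    intro a i
    simpa [t] using hf (Sum.inl (a, i))
  have hfr : ∀ e : G, f (Sum.inr e) = Sum.inl e ∨
      ∃ j : Fin r, f (Sum.inr e) = Sum.inr (e.1.2, j) := by
    intro e
    simpa [t] using hf (Sum.inr e)
  choose el hel hel1 using hfl
  refine ⟨Finset.univ.image (fun p : α × Fin r => (el p.1 p.2 : α × β)), ?_, ?_, ?_⟩
  · intro x hx
    simp only [Finset.mem_image, Finset.mem_univ, true_and] at hx
    obtain ⟨p, rfl⟩ := hx
    exact (el p.1 p.2).2
  · intro a
    have hcong : (Finset.univ.image (fun p : α × Fin r => (el p.1 p.2 : α × β))).filter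
        (fun x => x.1 = a) = Finset.univ.image (fun i : Fin r => (el a i : α × β)) := by
      ext x
      simp only [Finset.mem_filter, Finset.mem_image, Finset.mem_univ, true_and, Prod.exists]
      constructor
      · rintro ⟨⟨a', i, rfl⟩, hx⟩
        rw [hel1] at hx
        subst hx
        exact ⟨i, rfl⟩
      · rintro ⟨i, rfl⟩
        exact ⟨⟨a, i, rfl⟩, hel1 a i⟩
    rw [hcong, Finset.card_image_of_injective, Finset.card_univ, Fintype.card_fin]
    intro i j hij
    have : f (Sum.inl (a, i)) = f (Sum.inl (a, j)) := by
      rw [hel, hel, Subtype.ext hij]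
    simpa using hinj this
  · intro b
    have hex : ∀ j : Fin r, ∃ e : G, f (Sum.inr e) = Sum.inr (b, j) ∧ e.1.2 = b := by
      intro j
      obtain ⟨x, hx⟩ := hbij.2 (Sum.inr (b, j))
      rcases x with ⟨a, i⟩ | e
      · rw [hel] at hx; cases hx
      · refine ⟨e, hx, ?_⟩
        rcases hfr e with he | ⟨j', he⟩
        · rw [hx] at he; cases he
        · rw [hx] at he
          simp only [Sum.inr.injEq, Prod.mk.injEq] at he
          exact he.1.symm
    choose er her her2 using hex
    have hcong : (Finset.univ.image (fun p : α × Fin r => (el p.1 p.2 : α × β))).filter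
        (fun x => x.2 = b) = Finset.univ.image (fun j : Fin r => (er j : α × β)) := by
      ext x
      simp only [Finset.mem_filter, Finset.mem_image, Finset.mem_univ, true_and, Prod.exists]
      constructor
      · rintro ⟨⟨a', i, rfl⟩, hx⟩
        rcases hfr (el a' i) with he | ⟨j, he⟩
        · rw [← hel] at he
          have := hinj he
          cases this
        · refine ⟨j, ?_⟩
          rw [hx, ← her j] at he
          have := hinj he
          simp only [Sum.inr.injEq] at this
          rw [this]
      · rintro ⟨j, rfl⟩
        refine ⟨?_, her2 j⟩
        obtain ⟨x, hx⟩ := hbij.2 (Sum.inl (er j))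
        rcases x with ⟨a, i⟩ | e
        · rw [hel] at hx
          refine ⟨a, i, ?_⟩
          simpa using congrArg Subtype.val (Sum.inl.inj hx)
        · rcases hfr e with he | ⟨j', he⟩
          · have h1 := he.symm.trans hx
            simp only [Sum.inl.injEq] at h1
            subst h1
            rw [her] at he
            cases he
          · rw [hx] at he; cases he
    rw [hcong, Finset.card_image_of_injective, Finset.card_univ, Fintype.card_fin]
    intro i j hij
    have h1 := her i
    rw [Subtype.ext hij, her j] at h1
    simpa using h1.symm

/-- A nonempty regular bipartite graph has a perfect matching. -/
theorem exists_perfect_matching_of_regular (F : Finset (α × β)) (r : ℕ) (hr : 0 < r)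
    (hcard : Fintype.card α = Fintype.card β)
    (h1 : ∀ a, (F.filter fun x => x.1 = a).card = r)
    (h2 : ∀ b, (F.filter fun x => x.2 = b).card = r) :
    ∃ τ : α ≃ β, ∀ a, (a, τ a) ∈ F := by
  classical
  have hall : ∀ s : Finset α,
      s.card ≤ (s.biUnion fun a => Finset.univ.filter fun b => (a, b) ∈ F).card := by
    intro s
    set U := s.biUnion fun a => Finset.univ.filter fun b => (a, b) ∈ F with hU
    have e1 : (F.filter fun x => x.1 ∈ s).card = s.card * r := by
      rw [Finset.card_eq_sum_card_fiberwise (f := Prod.fst) (t := s)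
        (s := F.filter fun x => x.1 ∈ s) (fun x hx => by simpa using (Finset.mem_filter.1 hx).2)]
      rw [Finset.sum_const_nat]
      intro a ha
      rw [← h1 a, Finset.filter_filter]
      congr 1
      ext x
      simp only [Finset.mem_filter]
      constructor
      · rintro ⟨hx, -, hx'⟩; exact ⟨hx, hx'⟩
      · rintro ⟨hx, rfl⟩; exact ⟨hx, ha, rfl⟩
    have e2 : (F.filter fun x => x.2 ∈ U).card = U.card * r := by
      rw [Finset.card_eq_sum_card_fiberwise (f := Prod.snd) (t := U)
        (s := F.filter fun x => x.2 ∈ U) (fun x hx => by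
          simpa only [Finset.mem_coe] using (Finset.mem_filter.1 hx).2)]
      rw [Finset.sum_const_nat]
      intro a ha
      rw [← h2 a, Finset.filter_filter]
      congr 1
      ext x
      simp only [Finset.mem_filter]
      constructor
      · rintro ⟨hx, -, hx'⟩; exact ⟨hx, hx'⟩
      · rintro ⟨hx, rfl⟩; exact ⟨hx, ha, rfl⟩
    have e3 : (F.filter fun x => x.1 ∈ s).card ≤ (F.filter fun x => x.2 ∈ U).card := by
      refine Finset.card_le_card fun x hx => ?_
      rw [Finset.mem_filter] at hx ⊢
      refine ⟨hx.1, ?_⟩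
      rw [hU, Finset.mem_biUnion]
      exact ⟨x.1, hx.2, by simpa using hx.1⟩
    rw [e1, e2] at e3
    exact Nat.le_of_mul_le_mul_right e3 hr
  obtain ⟨f, hinj, hf⟩ := (Finset.all_card_le_biUnion_card_iff_exists_injective _).1 hall
  refine ⟨Equiv.ofBijective f
    ((Fintype.bijective_iff_injective_and_card f).2 ⟨hinj, hcard⟩), fun a => ?_⟩
  simpa using hf a

/-- A regular bipartite graph decomposes into perfect matchings. -/
theorem exists_matchings_of_regular (hcard : Fintype.card α = Fintype.card β) (r : ℕ) :
    ∀ F : Finset (α × β), (∀ a, (F.filter fun x => x.1 = a).card = r) →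
      (∀ b, (F.filter fun x => x.2 = b).card = r) →
      ∃ τ : Fin r → (α ≃ β), (∀ i a, (a, τ i a) ∈ F) ∧
        ∀ i j, i ≠ j → ∀ a, τ i a ≠ τ j a := by
  classical
  induction r with
  | zero => exact fun F _ _ => ⟨fun i => i.elim0, fun i => i.elim0, fun i => i.elim0⟩
  | succ r ih =>
    intro F h1 h2
    obtain ⟨τ₀, hτ₀⟩ := exists_perfect_matching_of_regular F (r + 1) r.succ_pos hcard h1 h2
    obtain ⟨τ, hτ, hne⟩ := ih (F.filter fun x => x.2 ≠ τ₀ x.1) (by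
        intro a
        have e : ((F.filter fun x => x.2 ≠ τ₀ x.1).filter fun x => x.1 = a) =
            (F.filter fun x => x.1 = a).erase (a, τ₀ a) := by
          ext ⟨x, y⟩
          simp only [Finset.mem_filter, Finset.mem_erase, ne_eq, Prod.mk.injEq]
          constructor
          · rintro ⟨⟨hF, hy⟩, rfl⟩
            exact ⟨fun hh => hy hh.2, hF, rfl⟩
          · rintro ⟨hh, hF, rfl⟩
            exact ⟨⟨hF, fun hy => hh ⟨rfl, hy⟩⟩, rfl⟩
        rw [e, Finset.card_erase_of_mem (by simp [hτ₀]), h1]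
        rfl) (by
        intro b
        have e : ((F.filter fun x => x.2 ≠ τ₀ x.1).filter fun x => x.2 = b) =
            (F.filter fun x => x.2 = b).erase (τ₀.symm b, b) := by
          ext ⟨x, y⟩
          simp only [Finset.mem_filter, Finset.mem_erase, ne_eq, Prod.mk.injEq]
          constructor
          · rintro ⟨⟨hF, hy⟩, rfl⟩
            refine ⟨fun hh => hy ?_, hF, rfl⟩
            rw [hh.1, Equiv.apply_symm_apply]
          · rintro ⟨hh, hF, rfl⟩
            refine ⟨⟨hF, fun hy => hh ⟨?_, rfl⟩⟩, rfl⟩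
            rw [hy, Equiv.symm_apply_apply]
        rw [e, Finset.card_erase_of_mem, h2]
        · rfl
        · have := hτ₀ (τ₀.symm b)
          rw [Equiv.apply_symm_apply] at this
          simp [this])
    refine ⟨Fin.cons τ₀ τ, ?_, ?_⟩
    · intro i a
      refine Fin.cases ?_ (fun i => ?_) i
      · simpa using hτ₀ a
      · simpa using (Finset.mem_filter.1 (hτ i a)).1
    · have key : ∀ i a, τ i a ≠ τ₀ a := fun i a => (Finset.mem_filter.1 (hτ i a)).2
      intro i j
      refine Fin.cases ?_ (fun i => ?_) i <;> refine Fin.cases ?_ (fun j => ?_) j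
      · exact fun h => absurd rfl h
      · intro _ a
        simpa using (key j a).symm
      · intro _ a
        simpa using key i a
      · intro hij a
        simpa using hne i j (fun hh => hij (by rw [hh])) a

/-- Edge-disjoint perfect matchings in a bipartite graph satisfying the cut condition. -/
theorem exists_disjoint_matchings (G : Finset (α × β)) (r : ℕ)
    (hcard : Fintype.card α = Fintype.card β)
    (h : ∀ (S : Finset α) (T : Finset β),
      r * (S.card + T.card) ≤ r * Fintype.card α + (edgesBetween G S T).card) :
    ∃ τ : Fin r → (α ≃ β), (∀ i a, (a, τ i a) ∈ G) ∧ ∀ i j, i ≠ j → ∀ a, τ i a ≠ τ j a := by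
  obtain ⟨F, hF, h1, h2⟩ := exists_regular_subgraph G r hcard h
  obtain ⟨τ, hτ, hne⟩ := exists_matchings_of_regular hcard r F h1 h2
  exact ⟨τ, fun i a => hF (hτ i a), hne⟩

end Factor

/-! ### Edge counts between large sets, from degrees and codegrees. -/

section Discrepancy

variable {α β : Type*} [DecidableEq α] [DecidableEq β]

theorem card_edgesBetween_eq_sum (G : Finset (α × β)) (S : Finset α) (T : Finset β) :
    ((edgesBetween G S T).card : ℝ) =
      ∑ a ∈ S, ∑ b ∈ T, if (a, b) ∈ G then (1 : ℝ) else 0 := by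
  rw [← Finset.sum_product', Finset.sum_boole]
  congr 2
  ext x
  simp only [edgesBetween, Finset.mem_filter, Finset.mem_product]
  tauto

theorem card_edgesBetween_swap (G : Finset (α × β)) (S : Finset α) (T : Finset β) :
    (edgesBetween (G.map (Equiv.prodComm α β).toEmbedding) T S).card =
      (edgesBetween G S T).card := by
  rw [← Finset.card_map (Equiv.prodComm α β).toEmbedding]
  congr 1
  ext ⟨x, y⟩
  simp [edgesBetween]
  tauto

variable [Fintype β]

set_option maxHeartbeats 400000 in
/-- The number of edges between `S` and `T` in a graph with large degrees and small codegrees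
on the side of `S`, when `T` is large. -/
theorem card_edgesBetween_ge_of_large (G : Finset (α × β)) (N : ℕ)
    (hβ : Fintype.card β = N) {d ε δ : ℝ} (hd : 0 < d) (hε : 0 ≤ ε)
    (hεδ : 2 * ε ≤ δ) (hδ1 : δ ≤ 1) (hεδ2 : 12 * ε ≤ δ ^ 2) (hN : 8 ≤ δ ^ 3 * d ^ 3 * N)
    (hdeg : ∀ a, (1 - ε) * d * N ≤ ((Finset.univ.filter fun b => (a, b) ∈ G).card : ℝ))
    (hco : ∀ a a', a ≠ a' →
      ((Finset.univ.filter fun b => (a, b) ∈ G ∧ (a', b) ∈ G).card : ℝ) ≤ (1 + ε) * d ^ 2 * N)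
    (S : Finset α) (T : Finset β) (hT : N ≤ 2 * T.card) (hST : N ≤ S.card + T.card) :
    (1 - δ) * (d * S.card * T.card) ≤ ((edgesBetween G S T).card : ℝ) := by
  have hδ : 0 ≤ δ := by linarith
  have hTN : T.card ≤ N := hβ ▸ Finset.card_le_univ T
  have hT' : (N : ℝ) ≤ 2 * T.card := by exact_mod_cast hT
  have hST' : (N : ℝ) ≤ S.card + T.card := by exact_mod_cast hST
  have hTN' : (T.card : ℝ) ≤ N := by exact_mod_cast hTN
  set s : ℝ := (S.card : ℝ) with hs
  set t : ℝ := (T.card : ℝ) with ht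
  have hs0 : 0 ≤ s := Nat.cast_nonneg _
  have ht0 : 0 ≤ t := Nat.cast_nonneg _
  have hN0 : (0 : ℝ) ≤ N := Nat.cast_nonneg _
  rw [card_edgesBetween_eq_sum]
  set g : α → β → ℝ := fun a b => if (a, b) ∈ G then 1 else 0 with hg
  have hg01 : ∀ a b, 0 ≤ g a b ∧ g a b ≤ 1 := by
    intro a b; simp only [hg]; split_ifs <;> norm_num
  have hdeg' : ∀ a, (1 - ε) * d * N ≤ ∑ b, g a b := by
    intro a
    simp only [hg, Finset.sum_boole]
    exact hdeg a
  -- For small `S` the degrees suffice: a vertex loses at most `N - t ≤ s` neighbours outside `T`,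
  -- which is within the allowed error. For larger `S` a second moment argument is used.
  by_cases hcase : s ≤ (δ - ε) * d * N
  · have h1 : ∀ a ∈ S, (1 - δ) * d * t ≤ ∑ b ∈ T, g a b := by
      intro a _
      have h2 : ∑ b, g a b = ∑ b ∈ T, g a b + ∑ b ∈ Tᶜ, g a b :=
        (Finset.sum_add_sum_compl T _).symm
      have h3 : ∑ b ∈ Tᶜ, g a b ≤ N - t := by
        calc ∑ b ∈ Tᶜ, g a b ≤ ∑ b ∈ Tᶜ, (1 : ℝ) :=
              Finset.sum_le_sum fun b _ => (hg01 a b).2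
          _ = (Tᶜ.card : ℝ) := by simp
          _ = N - t := by
              rw [Finset.card_compl, hβ, Nat.cast_sub hTN]
      have h4 := hdeg' a
      have h5 : (1 - δ) * d * t ≤ (1 - δ) * d * N :=
        mul_le_mul_of_nonneg_left hTN' (mul_nonneg (by linarith) hd.le)
      linarith
    calc (1 - δ) * (d * s * t) = ∑ a ∈ S, (1 - δ) * d * t := by
          rw [Finset.sum_const, nsmul_eq_mul, ← hs]; ring
      _ ≤ _ := Finset.sum_le_sum h1
  · push Not at hcase
    set D : β → ℝ := fun b => ∑ a ∈ S, g a b with hD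
    set e : ℝ := ∑ a ∈ S, ∑ b ∈ T, g a b with he
    have heD : e = ∑ b ∈ T, D b := Finset.sum_comm
    have hD1 : s * ((1 - ε) * d * N) ≤ ∑ b, D b := by
      rw [hD, Finset.sum_comm]
      calc s * ((1 - ε) * d * N) = ∑ a ∈ S, (1 - ε) * d * N := by
            rw [Finset.sum_const, nsmul_eq_mul]
        _ ≤ _ := Finset.sum_le_sum fun a _ => hdeg' a
    have hD2 : ∑ b, D b ^ 2 ≤ s ^ 2 * ((1 + ε) * d ^ 2 * N) + s * N := by
      have h1 : ∑ b, D b ^ 2 = ∑ a ∈ S, ∑ a' ∈ S, ∑ b, g a b * g a' b := by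
        simp only [hD, sq, Finset.sum_mul_sum]
        rw [Finset.sum_comm]
        refine Finset.sum_congr rfl fun a _ => ?_
        rw [Finset.sum_comm]
      have h2 : ∀ a ∈ S, ∀ a' ∈ S, ∑ b, g a b * g a' b ≤
          (1 + ε) * d ^ 2 * N + if a = a' then (N : ℝ) else 0 := by
        intro a _ a' _
        by_cases haa : a = a'
        · simp only [haa, if_true]
          have : ∑ b, g a' b * g a' b ≤ ∑ b : β, (1 : ℝ) :=
            Finset.sum_le_sum fun b _ => by nlinarith [hg01 a' b]
          rw [Finset.sum_const, Finset.card_univ, hβ, nsmul_eq_mul, mul_one] at this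
          have h0 : 0 ≤ (1 + ε) * d ^ 2 * N := by positivity
          linarith
        · simp only [haa, if_false, add_zero]
          refine le_trans (le_of_eq ?_) (hco a a' haa)
          rw [← Finset.sum_boole]
          refine Finset.sum_congr rfl fun b _ => ?_
          simp only [hg]
          split_ifs <;> simp_all
      rw [h1]
      calc ∑ a ∈ S, ∑ a' ∈ S, ∑ b, g a b * g a' b
          ≤ ∑ a ∈ S, ∑ a' ∈ S, ((1 + ε) * d ^ 2 * N + if a = a' then (N : ℝ) else 0) :=
            Finset.sum_le_sum fun a ha => Finset.sum_le_sum fun a' ha' => h2 a ha a' ha'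
        _ = ∑ a ∈ S, (s * ((1 + ε) * d ^ 2 * N) + N) := by
            refine Finset.sum_congr rfl fun a ha => ?_
            rw [Finset.sum_add_distrib, Finset.sum_const, nsmul_eq_mul, Finset.sum_ite_eq,
              if_pos ha]
        _ = _ := by
            rw [Finset.sum_const, nsmul_eq_mul]; ring
    -- Cauchy–Schwarz over `T`, then the sum of squares is extended to all of `β`. On expanding, the
    -- main terms cancel: `1 - 2 * (1 - ε) + (1 + ε) = 3 * ε`. The term `s * N` is the diagonal
    -- contribution.
    have hvar : (d * s * t - e) ^ 2 ≤ t * (s * N + 3 * ε * d ^ 2 * s ^ 2 * N) := by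
      have h1 : d * s * t - e = ∑ b ∈ T, (d * s - D b) := by
        rw [Finset.sum_sub_distrib, heD, Finset.sum_const, nsmul_eq_mul]; ring
      have h2 : ∑ b ∈ T, (d * s - D b) ^ 2 ≤ ∑ b, (d * s - D b) ^ 2 :=
        Finset.sum_le_sum_of_subset_of_nonneg (Finset.subset_univ _) fun _ _ _ => sq_nonneg _
      have h3 : ∑ b, (d * s - D b) ^ 2 =
          N * (d * s) ^ 2 - 2 * (d * s) * ∑ b, D b + ∑ b, D b ^ 2 := by
        simp only [sub_sq]
        rw [Finset.sum_add_distrib, Finset.sum_sub_distrib, Finset.sum_const, Finset.card_univ,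
          hβ, nsmul_eq_mul, Finset.mul_sum]
      have h4 : d * s * (s * ((1 - ε) * d * N)) ≤ d * s * ∑ b, D b :=
        mul_le_mul_of_nonneg_left hD1 (by positivity)
      rw [h1]
      refine sq_sum_le_card_mul_sum_sq.trans (mul_le_mul_of_nonneg_left ?_ ht0)
      refine h2.trans ?_
      rw [h3]
      linarith
    have hspos : δ / 2 * d * N ≤ s := by
      refine le_trans ?_ hcase.le
      have : 0 ≤ d * N := by positivity
      have := mul_nonneg (sub_nonneg.2 hεδ) this
      linarith
    have h4s : 4 ≤ δ ^ 2 * d ^ 2 * s := by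
      have : δ ^ 2 * d ^ 2 * (δ / 2 * d * N) ≤ δ ^ 2 * d ^ 2 * s :=
        mul_le_mul_of_nonneg_left hspos (by positivity)
      linarith
    have hb : t * (s * N + 3 * ε * d ^ 2 * s ^ 2 * N) ≤ (δ * (d * s * t)) ^ 2 := by
      have h1 : s * N + 3 * ε * d ^ 2 * s ^ 2 * N ≤ (s + 3 * ε * d ^ 2 * s ^ 2) * (2 * t) := by
        have h0 : 0 ≤ s + 3 * ε * d ^ 2 * s ^ 2 := by positivity
        calc s * N + 3 * ε * d ^ 2 * s ^ 2 * N = (s + 3 * ε * d ^ 2 * s ^ 2) * N := by ring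
          _ ≤ _ := mul_le_mul_of_nonneg_left hT' h0
      -- Each of the two terms takes half of the right side: the diagonal one because `δ ^ 2 * d ^ 2
      -- * s ≥ 4`, the other because `12 * ε ≤ δ ^ 2`.
      have h2 : 2 * (s + 3 * ε * d ^ 2 * s ^ 2) ≤ δ ^ 2 * d ^ 2 * s ^ 2 := by
        have h3 : 0 ≤ d ^ 2 * s ^ 2 := by positivity
        have h4 := mul_le_mul_of_nonneg_right hεδ2 h3
        have h5 := mul_le_mul_of_nonneg_right h4s hs0
        linarith
      calc t * (s * N + 3 * ε * d ^ 2 * s ^ 2 * N)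
          ≤ t * ((s + 3 * ε * d ^ 2 * s ^ 2) * (2 * t)) := mul_le_mul_of_nonneg_left h1 ht0
        _ = t ^ 2 * (2 * (s + 3 * ε * d ^ 2 * s ^ 2)) := by ring
        _ ≤ t ^ 2 * (δ ^ 2 * d ^ 2 * s ^ 2) := mul_le_mul_of_nonneg_left h2 (by positivity)
        _ = _ := by ring
    have := abs_le_of_sq_le_sq (hvar.trans hb) (by positivity)
    linarith [le_abs_self (d * s * t - e)]

variable [Fintype α]

/-- The number of edges between any two sets that are not too small in a bipartite graph with
large degrees and small codegrees on both sides. -/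
theorem card_edgesBetween_ge (G : Finset (α × β)) (N : ℕ)
    (hα : Fintype.card α = N) (hβ : Fintype.card β = N) {d ε δ : ℝ} (hd : 0 < d) (hε : 0 ≤ ε)
    (hεδ : 2 * ε ≤ δ) (hδ1 : δ ≤ 1) (hεδ2 : 12 * ε ≤ δ ^ 2) (hN : 8 ≤ δ ^ 3 * d ^ 3 * N)
    (hdeg₁ : ∀ a, (1 - ε) * d * N ≤ ((Finset.univ.filter fun b => (a, b) ∈ G).card : ℝ))
    (hdeg₂ : ∀ b, (1 - ε) * d * N ≤ ((Finset.univ.filter fun a => (a, b) ∈ G).card : ℝ))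
    (hco₁ : ∀ a a', a ≠ a' →
      ((Finset.univ.filter fun b => (a, b) ∈ G ∧ (a', b) ∈ G).card : ℝ) ≤ (1 + ε) * d ^ 2 * N)
    (hco₂ : ∀ b b', b ≠ b' →
      ((Finset.univ.filter fun a => (a, b) ∈ G ∧ (a, b') ∈ G).card : ℝ) ≤ (1 + ε) * d ^ 2 * N)
    (S : Finset α) (T : Finset β) (hST : N ≤ S.card + T.card) :
    (1 - δ) * (d * S.card * T.card) ≤ ((edgesBetween G S T).card : ℝ) := by
  rcases le_or_gt N (2 * T.card) with hT | hT
  · exact card_edgesBetween_ge_of_large G N hβ hd hε hεδ hδ1 hεδ2 hN hdeg₁ hco₁ S T hT hST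
  · have := card_edgesBetween_ge_of_large (G.map (Equiv.prodComm α β).toEmbedding) N hα hd hε
      hεδ hδ1 hεδ2 hN (by simpa using hdeg₂) (by simpa using hco₂) T S (by omega) (by omega)
    rw [card_edgesBetween_swap] at this
    linarith

end Discrepancy

/-! ### Concentration for functions of a random permutation. -/

section Concentration

/-- Hoeffding's lemma for a uniform variable: by convexity the exponential lies below its chord on
`[-d, d]`, the linear term of the chord averages to zero, and `cosh d ≤ exp (d ^ 2 / 2)`. -/
theorem sum_exp_le_of_abs_sub_le {ι : Type*} [Fintype ι] [Nonempty ι] (x : ι → ℝ) (m d : ℝ)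
    (hm : ∑ i, x i = Fintype.card ι * m) (hx : ∀ i, |x i - m| ≤ d) :
    ∑ i, Real.exp (x i) ≤ Fintype.card ι * Real.exp (m + d ^ 2 / 2) := by
  have hd : 0 ≤ d := (abs_nonneg _).trans (hx (Classical.arbitrary ι))
  have h1 : ∀ i, Real.exp (x i - m) ≤ Real.cosh d + (x i - m) / d * Real.sinh d := by
    intro i
    rcases hd.eq_or_lt with h0 | h0
    · have := hx i
      rw [← h0] at this ⊢
      rw [abs_nonpos_iff.1 this]
      simp
    · have := Real.exp_mul_le_cosh_add_mul_sinh (t := (x i - m) / d)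
        (by rw [abs_div, abs_of_pos h0]; exact (div_le_one h0).2 (hx i)) d
      rwa [div_mul_cancel₀ _ h0.ne'] at this
  have h2 : ∑ i, Real.exp (x i - m) ≤ Fintype.card ι * Real.exp (d ^ 2 / 2) := by
    refine (Finset.sum_le_sum fun i _ => h1 i).trans ?_
    rw [Finset.sum_add_distrib, ← Finset.sum_mul, ← Finset.sum_div, Finset.sum_sub_distrib, hm,
      Finset.sum_const, Finset.sum_const, Finset.card_univ, nsmul_eq_mul, nsmul_eq_mul, sub_self,
      zero_div, zero_mul, add_zero]
    exact mul_le_mul_of_nonneg_left (Real.cosh_le_exp_half_sq d) (Nat.cast_nonneg _)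
  calc ∑ i, Real.exp (x i) = Real.exp m * ∑ i, Real.exp (x i - m) := by
        rw [Finset.mul_sum]
        exact Finset.sum_congr rfl fun i _ => by rw [← Real.exp_add]; congr 1; ring
    _ ≤ Real.exp m * (Fintype.card ι * Real.exp (d ^ 2 / 2)) :=
        mul_le_mul_of_nonneg_left h2 (Real.exp_nonneg _)
    _ = _ := by rw [Real.exp_add]; ring

/-- Changing the image of `0` amounts to one transposition on the left, so the averages conditioned
on that image differ little. -/
theorem decomposeFin_symm_eq_swap_mul {n : ℕ} (p : Fin (n + 1)) (e : Equiv.Perm (Fin n)) :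
    Equiv.Perm.decomposeFin.symm (p, e) =
      Equiv.swap 0 p * Equiv.Perm.decomposeFin.symm (0, e) := by
  ext x
  refine Fin.cases ?_ (fun x => ?_) x <;> simp

/-- A transposition of the remaining points is again a left transposition of the whole permutation,
so conditioning on the image of `0` keeps the Lipschitz constant. This is what lets the induction in
`sum_exp_perm_le` run. -/
theorem decomposeFin_symm_swap_mul {n : ℕ} (p : Fin (n + 1)) (x y : Fin n)
    (e : Equiv.Perm (Fin n)) :
    Equiv.Perm.decomposeFin.symm (p, Equiv.swap x y * e) =
      Equiv.swap (Equiv.swap 0 p x.succ) (Equiv.swap 0 p y.succ) *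
        Equiv.Perm.decomposeFin.symm (p, e) := by
  rw [decomposeFin_symm_eq_swap_mul p e, ← mul_assoc, ← Equiv.mul_swap_eq_swap_mul,
    mul_assoc, decomposeFin_symm_eq_swap_mul]
  congr 1
  ext z
  refine Fin.cases ?_ (fun z => ?_) z
  · have h1 := Fin.succ_ne_zero x
    have h2 := Fin.succ_ne_zero y
    simp [Equiv.swap_apply_of_ne_of_ne h1.symm h2.symm]
  · simp [Equiv.swap_apply_def, apply_ite Fin.succ]

/-- Exponential moments of a function on permutations that changes little under
transpositions. -/
theorem sum_exp_perm_le (n : ℕ) : ∀ (f : Equiv.Perm (Fin n) → ℝ) (c m : ℝ),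
    (∀ σ x y, |f (Equiv.swap x y * σ) - f σ| ≤ c) → ∑ σ, f σ = n.factorial * m →
    ∑ σ, Real.exp (f σ) ≤ n.factorial * Real.exp (m + 2 * c ^ 2 * n) := by
  induction n with
  | zero =>
    intro f c m _ hm
    rw [Fintype.sum_unique] at hm ⊢
    simp at hm
    simp [hm]
  | succ n ih =>
    intro f c m hf hm
    set g : Fin (n + 1) → Equiv.Perm (Fin n) → ℝ :=
      fun p e => f (Equiv.Perm.decomposeFin.symm (p, e)) with hg
    have hsum : ∀ F : Equiv.Perm (Fin (n + 1)) → ℝ,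
        ∑ σ, F σ = ∑ p, ∑ e, F (Equiv.Perm.decomposeFin.symm (p, e)) := by
      intro F
      rw [← Equiv.sum_comp Equiv.Perm.decomposeFin.symm F, Fintype.sum_prod_type]
    have hfac : (0 : ℝ) < n.factorial := by exact_mod_cast n.factorial_pos
    -- The mean conditioned on `0 ↦ p`: one step of the martingale that reveals the permutation
    -- value by value.
    set μ : Fin (n + 1) → ℝ := fun p => (∑ e, g p e) / n.factorial with hμ
    have hstep : ∀ p, ∑ e, Real.exp (g p e) ≤
        n.factorial * Real.exp (μ p + 2 * c ^ 2 * n) := by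
      intro p
      refine ih (g p) c (μ p) ?_ ?_
      · intro σ x y
        simp only [hg]
        rw [decomposeFin_symm_swap_mul]
        exact hf _ _ _
      · simp only [hμ]
        field_simp
    have hdiff : ∀ p, |μ p - μ 0| ≤ c := by
      intro p
      simp only [hμ]
      rw [← sub_div, ← Finset.sum_sub_distrib, abs_div, abs_of_pos hfac, div_le_iff₀ hfac]
      refine (Finset.abs_sum_le_sum_abs _ _).trans ?_
      refine (Finset.sum_le_sum (g := fun _ => c) fun e _ => ?_).trans ?_
      · simp only [hg]
        rw [decomposeFin_symm_eq_swap_mul p e]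
        exact hf _ _ _
      · rw [Finset.sum_const, Finset.card_univ, Fintype.card_perm, Fintype.card_fin,
          nsmul_eq_mul, mul_comm]
    have hμm : ∑ p, μ p = (n + 1 : ℕ) * m := by
      simp only [hμ]
      rw [← Finset.sum_div, ← hsum f, hm, Nat.factorial_succ]
      push_cast
      field_simp
    have hμ0 : |μ 0 - m| ≤ c := by
      have h1 : ((n + 1 : ℕ) : ℝ) * (μ 0 - m) = ∑ p, (μ 0 - μ p) := by
        rw [Finset.sum_sub_distrib, hμm, Finset.sum_const, Finset.card_univ, Fintype.card_fin,
          nsmul_eq_mul]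
        ring
      have h2 : |((n + 1 : ℕ) : ℝ) * (μ 0 - m)| ≤ ((n + 1 : ℕ) : ℝ) * c := by
        rw [h1]
        refine (Finset.abs_sum_le_sum_abs _ _).trans ?_
        refine (Finset.sum_le_sum (g := fun _ => c) fun p _ => ?_).trans ?_
        · rw [abs_sub_comm]; exact hdiff p
        · rw [Finset.sum_const, Finset.card_univ, Fintype.card_fin, nsmul_eq_mul]
      rw [abs_mul, Nat.abs_cast] at h2
      exact le_of_mul_le_mul_left h2 (by positivity)
    -- Any two conditional means differ from `μ 0`, and `μ 0` from `m`, by at most `c`. The radius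
    -- `2 * c` costs `(2 * c) ^ 2 / 2 = 2 * c ^ 2` in the exponent per revealed value.
    have key := sum_exp_le_of_abs_sub_le μ m (2 * c) (by rw [hμm, Fintype.card_fin])
      (fun p => by
        calc |μ p - m| ≤ |μ p - μ 0| + |μ 0 - m| := abs_sub_le _ _ _
          _ ≤ 2 * c := by linarith [hdiff p])
    rw [hsum]
    calc ∑ p, ∑ e, Real.exp (f (Equiv.Perm.decomposeFin.symm (p, e)))
        ≤ ∑ p, n.factorial * Real.exp (μ p + 2 * c ^ 2 * n) :=
          Finset.sum_le_sum fun p _ => hstep p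
      _ = n.factorial * Real.exp (2 * c ^ 2 * n) * ∑ p, Real.exp (μ p) := by
          rw [Finset.mul_sum]
          exact Finset.sum_congr rfl fun p _ => by rw [Real.exp_add]; ring
      _ ≤ n.factorial * Real.exp (2 * c ^ 2 * n) *
          (Fintype.card (Fin (n + 1)) * Real.exp (m + (2 * c) ^ 2 / 2)) :=
          mul_le_mul_of_nonneg_left key (by positivity)
      _ = _ := by
          have : m + 2 * c ^ 2 * ((n + 1 : ℕ) : ℝ) =
              2 * c ^ 2 * n + (m + (2 * c) ^ 2 / 2) := by push_cast; ring
          rw [this, Real.exp_add (2 * c ^ 2 * n), Fintype.card_fin, Nat.factorial_succ]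
          push_cast
          ring

/-- The upper tail of a function on permutations that changes little under transpositions. -/
theorem card_perm_ge_le {n : ℕ} (hn : 0 < n) (f : Equiv.Perm (Fin n) → ℝ) {c : ℝ} (hc : 0 < c)
    (m : ℝ) {t : ℝ} (ht : 0 ≤ t) (hf : ∀ σ x y, |f (Equiv.swap x y * σ) - f σ| ≤ c)
    (hm : ∑ σ, f σ = n.factorial * m) :
    ((Finset.univ.filter fun σ => m + t ≤ f σ).card : ℝ) ≤
      n.factorial * Real.exp (-(t ^ 2 / (8 * c ^ 2 * n))) := by
  have hn' : (0 : ℝ) < n := by exact_mod_cast hn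
  -- The minimiser of `2 * l ^ 2 * c ^ 2 * n - l * t` in the Chernoff bound.
  set l : ℝ := t / (4 * c ^ 2 * n) with hl
  have hl0 : 0 ≤ l := by positivity
  have h1 := sum_exp_perm_le n (fun σ => l * f σ) (l * c) (l * m)
    (fun σ x y => by
      rw [← mul_sub, abs_mul, abs_of_nonneg hl0]
      exact mul_le_mul_of_nonneg_left (hf σ x y) hl0)
    (by rw [← Finset.mul_sum, hm]; ring)
  have h2 : ((Finset.univ.filter fun σ => m + t ≤ f σ).card : ℝ) * Real.exp (l * (m + t)) ≤
      ∑ σ, Real.exp (l * f σ) := by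
    rw [← nsmul_eq_mul, ← Finset.sum_const]
    calc ∑ _σ ∈ Finset.univ.filter fun σ => m + t ≤ f σ, Real.exp (l * (m + t))
        ≤ ∑ σ ∈ Finset.univ.filter fun σ => m + t ≤ f σ, Real.exp (l * f σ) :=
          Finset.sum_le_sum fun σ hσ => Real.exp_le_exp.2
            (mul_le_mul_of_nonneg_left (Finset.mem_filter.1 hσ).2 hl0)
      _ ≤ _ := Finset.sum_le_sum_of_subset_of_nonneg (Finset.subset_univ _)
          fun _ _ _ => Real.exp_nonneg _
  refine le_of_mul_le_mul_right (h2.trans (h1.trans (le_of_eq ?_))) (Real.exp_pos (l * (m + t)))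
  rw [mul_assoc (n.factorial : ℝ) (Real.exp _), ← Real.exp_add]
  congr 2
  simp only [hl]
  field_simp
  ring

/-- The lower tail of a function on permutations that changes little under transpositions. -/
theorem card_perm_le_le {n : ℕ} (hn : 0 < n) (f : Equiv.Perm (Fin n) → ℝ) {c : ℝ} (hc : 0 < c)
    (m : ℝ) {t : ℝ} (ht : 0 ≤ t) (hf : ∀ σ x y, |f (Equiv.swap x y * σ) - f σ| ≤ c)
    (hm : ∑ σ, f σ = n.factorial * m) :
    ((Finset.univ.filter fun σ => f σ ≤ m - t).card : ℝ) ≤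
      n.factorial * Real.exp (-(t ^ 2 / (8 * c ^ 2 * n))) := by
  have := card_perm_ge_le hn (fun σ => - f σ) hc (-m) ht
    (fun σ x y => by rw [← neg_sub', abs_neg]; exact hf σ x y)
    (by rw [Finset.sum_neg_distrib, hm]; ring)
  rwa [Finset.filter_congr fun σ _ =>
    show -m + t ≤ - f σ ↔ f σ ≤ m - t by constructor <;> intro h <;> linarith] at this

end Concentration

/-! ### Images of disjoint blocks under a random permutation. -/

section Blocks

variable {n N : ℕ}

/-- The number of blocks `D j` whose image under `σ` belongs to the family `F`. -/
def blockCount (D : Fin N → Finset (Fin n)) (F : Finset (Finset (Fin n)))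
    (σ : Equiv.Perm (Fin n)) : ℕ :=
  (Finset.univ.filter fun j => (D j).map σ.toEmbedding ∈ F).card

/-- All targets of the right size are equally likely, because left multiplication by a permutation
carrying one target to another is a bijection; there are `n.choose D.card` of them. -/
theorem card_perm_map_eq (D T : Finset (Fin n)) (h : T.card = D.card) :
    (Finset.univ.filter fun σ : Equiv.Perm (Fin n) => D.map σ.toEmbedding = T).card *
      n.choose D.card = n.factorial := by
  have hconst : ∀ T' : Finset (Fin n), T'.card = D.card →
      (Finset.univ.filter fun σ : Equiv.Perm (Fin n) => D.map σ.toEmbedding = T').card =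
      (Finset.univ.filter fun σ : Equiv.Perm (Fin n) => D.map σ.toEmbedding = T).card := by
    intro T' h'
    let e : {x // x ∈ T'} ≃ {x // x ∈ T} := Finset.equivOfCardEq (h'.trans h.symm)
    set τ : Equiv.Perm (Fin n) := e.extendSubtype with hτ
    have hτT : T'.map τ.toEmbedding = T := by
      refine Finset.eq_of_subset_of_card_le ?_ (by rw [Finset.card_map, h, h'])
      intro y hy
      obtain ⟨x, hx, rfl⟩ := Finset.mem_map.1 hy
      exact e.extendSubtype_mem x hx
    have hmul : ∀ (ρ σ : Equiv.Perm (Fin n)) (A : Finset (Fin n)),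
        A.map (ρ * σ).toEmbedding = (A.map σ.toEmbedding).map ρ.toEmbedding := by
      intro ρ σ A
      rw [Finset.map_map]
      rfl
    refine Finset.card_bij (fun σ _ => τ * σ) ?_ ?_ ?_
    · intro σ hσ
      simp only [Finset.mem_filter, Finset.mem_univ, true_and] at hσ ⊢
      rw [hmul, hσ, hτT]
    · intro σ _ σ' _ hh
      exact mul_left_cancel hh
    · intro σ hσ
      simp only [Finset.mem_filter, Finset.mem_univ, true_and] at hσ
      refine ⟨τ⁻¹ * σ, ?_, by group⟩
      simp only [Finset.mem_filter, Finset.mem_univ, true_and]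
      rw [hmul, hσ, ← hτT, ← hmul]
      simp [Equiv.Perm.one_def]
  have hsum : (Finset.univ : Finset (Equiv.Perm (Fin n))).card =
      ∑ T' ∈ Finset.powersetCard D.card Finset.univ,
        (Finset.univ.filter fun σ : Equiv.Perm (Fin n) => D.map σ.toEmbedding = T').card := by
    refine Finset.card_eq_sum_card_fiberwise fun σ _ => ?_
    simp [Finset.mem_powersetCard]
  rw [Finset.sum_congr rfl fun T' hT' => hconst T' (Finset.mem_powersetCard.1 hT').2,
    Finset.sum_const, Finset.card_powersetCard, Finset.card_univ, Fintype.card_perm,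
    Finset.card_univ, Fintype.card_fin, smul_eq_mul] at hsum
  rw [hsum, mul_comm]

theorem card_perm_map_mem (D : Finset (Fin n)) (F : Finset (Finset (Fin n)))
    (hF : ∀ T ∈ F, T.card = D.card) :
    ((Finset.univ.filter fun σ : Equiv.Perm (Fin n) => D.map σ.toEmbedding ∈ F).card : ℝ) =
      n.factorial * (F.card / n.choose D.card) := by
  have hc : (0 : ℝ) < n.choose D.card := by
    have := Finset.card_le_univ D
    rw [Fintype.card_fin] at this
    exact_mod_cast Nat.choose_pos this
  have h1 : (Finset.univ.filter fun σ : Equiv.Perm (Fin n) => D.map σ.toEmbedding ∈ F).card =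
      ∑ T ∈ F,
        (Finset.univ.filter fun σ : Equiv.Perm (Fin n) => D.map σ.toEmbedding = T).card := by
    rw [Finset.card_eq_sum_card_fiberwise (f := fun σ => D.map σ.toEmbedding) (t := F)
      (s := Finset.univ.filter fun σ : Equiv.Perm (Fin n) => D.map σ.toEmbedding ∈ F)
      (fun σ hσ => by simpa using hσ)]
    refine Finset.sum_congr rfl fun T hT => ?_
    rw [Finset.filter_filter]
    congr 1
    ext σ
    simp only [Finset.mem_filter, Finset.mem_univ, true_and]
    exact ⟨fun h => h.2, fun h => ⟨h ▸ hT, h⟩⟩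
  have h2 : ∀ T ∈ F,
      ((Finset.univ.filter fun σ : Equiv.Perm (Fin n) => D.map σ.toEmbedding = T).card : ℝ) =
        n.factorial / n.choose D.card := by
    intro T hT
    rw [eq_div_iff hc.ne']
    exact_mod_cast card_perm_map_eq D T (hF T hT)
  rw [h1, Nat.cast_sum, Finset.sum_congr rfl h2, Finset.sum_const, nsmul_eq_mul]
  ring

theorem sum_blockCount (D : Fin N → Finset (Fin n)) (F : Finset (Finset (Fin n))) (c : ℕ)
    (hD : ∀ j, (D j).card = c) (hF : ∀ T ∈ F, T.card = c) :
    ∑ σ, (blockCount D F σ : ℝ) = n.factorial * (N * F.card / n.choose c) := by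
  have h1 : ∀ σ, (blockCount D F σ : ℝ) =
      ∑ j, if (D j).map σ.toEmbedding ∈ F then (1 : ℝ) else 0 := by
    intro σ
    rw [Finset.sum_boole, blockCount]
  simp only [h1]
  rw [Finset.sum_comm]
  have h2 : ∀ j, (∑ σ : Equiv.Perm (Fin n),
      if (D j).map σ.toEmbedding ∈ F then (1 : ℝ) else 0) =
        n.factorial * (F.card / n.choose c) := by
    intro j
    rw [Finset.sum_boole, card_perm_map_mem (D j) F (fun T hT => by rw [hF T hT, hD]), hD]
  rw [Finset.sum_congr rfl fun j _ => h2 j, Finset.sum_const, Finset.card_univ,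
    Fintype.card_fin, nsmul_eq_mul]
  ring

/-- Only blocks whose images contain `x` or `y` are affected, and disjointness leaves at most one
block for each. -/
theorem abs_blockCount_swap_sub_le (D : Fin N → Finset (Fin n))
    (hD : ∀ i j, i ≠ j → Disjoint (D i) (D j)) (F : Finset (Finset (Fin n)))
    (σ : Equiv.Perm (Fin n)) (x y : Fin n) :
    |(blockCount D F (Equiv.swap x y * σ) : ℝ) - blockCount D F σ| ≤ 2 := by
  have h1 : ∀ σ, (blockCount D F σ : ℝ) =
      ∑ j, if (D j).map σ.toEmbedding ∈ F then (1 : ℝ) else 0 := by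
    intro σ
    rw [Finset.sum_boole, blockCount]
  have hone : ∀ z : Fin n, (Finset.univ.filter fun j => z ∈ (D j).map σ.toEmbedding).card ≤ 1 := by
    intro z
    rw [Finset.card_le_one]
    intro i hi j hj
    simp only [Finset.mem_filter, Finset.mem_univ, true_and] at hi hj
    by_contra hij
    exact Finset.disjoint_left.1 ((Finset.disjoint_map σ.toEmbedding).2 (hD i j hij)) hi hj
  set J := (Finset.univ.filter fun j => x ∈ (D j).map σ.toEmbedding) ∪
    (Finset.univ.filter fun j => y ∈ (D j).map σ.toEmbedding) with hJ
  have hJ2 : J.card ≤ 2 := (Finset.card_union_le _ _).trans (by linarith [hone x, hone y])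
  have hout : ∀ j, j ∉ J →
      (D j).map (Equiv.swap x y * σ).toEmbedding = (D j).map σ.toEmbedding := by
    intro j hj
    simp only [hJ, Finset.mem_union, Finset.mem_filter, Finset.mem_univ, true_and,
      not_or] at hj
    rw [show (Equiv.swap x y * σ).toEmbedding =
      σ.toEmbedding.trans (Equiv.swap x y).toEmbedding from rfl, ← Finset.map_map]
    ext z
    rw [Finset.mem_map_equiv, Equiv.symm_swap]
    rcases eq_or_ne z x with rfl | hzx
    · simp only [Equiv.swap_apply_left]
      exact ⟨fun h => absurd h hj.2, fun h => absurd h hj.1⟩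
    rcases eq_or_ne z y with rfl | hzy
    · simp only [Equiv.swap_apply_right]
      exact ⟨fun h => absurd h hj.1, fun h => absurd h hj.2⟩
    rw [Equiv.swap_apply_of_ne_of_ne hzx hzy]
  rw [h1, h1, ← Finset.sum_sub_distrib,
    ← Finset.sum_subset (Finset.subset_univ J) (fun j _ hj => by rw [hout j hj, sub_self])]
  refine (Finset.abs_sum_le_sum_abs _ _).trans ?_
  refine (Finset.sum_le_sum (g := fun _ => (1 : ℝ)) fun j _ => ?_).trans ?_
  · split_ifs <;> simp
  · rw [Finset.sum_const, nsmul_eq_mul, mul_one]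
    exact_mod_cast hJ2

theorem card_blockCount_ge_le (hn : 0 < n) (D : Fin N → Finset (Fin n))
    (hD : ∀ i j, i ≠ j → Disjoint (D i) (D j)) (F : Finset (Finset (Fin n))) (c : ℕ)
    (hDc : ∀ j, (D j).card = c) (hF : ∀ T ∈ F, T.card = c) {t u : ℝ} (ht : 0 ≤ t)
    (hu : (N * F.card / n.choose c : ℝ) + t ≤ u) :
    ((Finset.univ.filter fun σ => u ≤ (blockCount D F σ : ℝ)).card : ℝ) ≤
      n.factorial * Real.exp (-(t ^ 2 / (32 * n))) := by
  have := card_perm_ge_le hn (fun σ => (blockCount D F σ : ℝ)) two_pos _ ht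
    (abs_blockCount_swap_sub_le D hD F) (sum_blockCount D F c hDc hF)
  norm_num at this
  refine le_trans ?_ this
  exact_mod_cast Finset.card_le_card
    (Finset.monotone_filter_right _ fun σ _ hσ => hu.trans hσ)

theorem card_blockCount_le_le (hn : 0 < n) (D : Fin N → Finset (Fin n))
    (hD : ∀ i j, i ≠ j → Disjoint (D i) (D j)) (F : Finset (Finset (Fin n))) (c : ℕ)
    (hDc : ∀ j, (D j).card = c) (hF : ∀ T ∈ F, T.card = c) {t u : ℝ} (ht : 0 ≤ t)
    (hu : u ≤ (N * F.card / n.choose c : ℝ) - t) :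
    ((Finset.univ.filter fun σ => (blockCount D F σ : ℝ) ≤ u).card : ℝ) ≤
      n.factorial * Real.exp (-(t ^ 2 / (32 * n))) := by
  have := card_perm_le_le hn (fun σ => (blockCount D F σ : ℝ)) two_pos _ ht
    (abs_blockCount_swap_sub_le D hD F) (sum_blockCount D F c hDc hF)
  norm_num at this
  refine le_trans ?_ this
  exact_mod_cast Finset.card_le_card
    (Finset.monotone_filter_right _ fun σ _ hσ => le_trans hσ hu)

end Blocks

/-! ### Random sampling and random colouring. -/

section Sampling

/-- Sampling `r` points independently from `P`, no event of probability at most `q` happens much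
more often than `r * q` times. -/
theorem exists_balanced_sample {α β : Type*} [DecidableEq α] (P : Finset α) (hP : P.Nonempty)
    (E : Finset β) (R : α → β → Prop) [∀ x e, Decidable (R x e)] {q l : ℝ}
    (hl0 : 0 ≤ l) (hl1 : l ≤ 1) (r K : ℕ)
    (hq : ∀ e ∈ E, ((P.filter fun x => R x e).card : ℝ) ≤ q * P.card)
    (hK : r * q * (1 + 2 * l) ≤ K) (hE : E.card * Real.exp (-(r * q * l ^ 2)) < 1) :
    ∃ f : Fin r → α, (∀ i, f i ∈ P) ∧
      ∀ e ∈ E, (Finset.univ.filter fun i => R (f i) e).card ≤ K := by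
  -- Exponential Markov inequality: if every sample failed, each would contribute at least 1 to the
  -- summed exponential moments, whose total is too small by `hE`.
  by_contra! hcon
  set Ω := Fintype.piFinset (fun _ : Fin r => P) with hΩ
  have hPc : (0 : ℝ) < P.card := by exact_mod_cast hP.card_pos
  have hexp : Real.exp l - 1 ≤ l + l ^ 2 := by
    have := Real.abs_exp_sub_one_sub_id_le (x := l) (by rwa [abs_of_nonneg hl0])
    linarith [le_abs_self (Real.exp l - 1 - l)]
  have h1 : ∀ f ∈ Ω, (1 : ℝ) ≤
      ∑ e ∈ E, Real.exp (l * ((Finset.univ.filter fun i => R (f i) e).card - K)) := by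
    intro f hf
    obtain ⟨e, he, hlt⟩ := hcon f fun i => Fintype.mem_piFinset.1 hf i
    refine le_trans ?_ (Finset.single_le_sum (f := fun e =>
      Real.exp (l * ((Finset.univ.filter fun i => R (f i) e).card - K)))
      (fun _ _ => Real.exp_nonneg _) he)
    refine Real.one_le_exp (mul_nonneg hl0 ?_)
    have : (K : ℝ) < (Finset.univ.filter fun i => R (f i) e).card := by exact_mod_cast hlt
    linarith
  have h2 : ∀ e ∈ E, ∑ f ∈ Ω,
      Real.exp (l * ((Finset.univ.filter fun i => R (f i) e).card - K)) ≤
        (P.card : ℝ) ^ r * Real.exp (-(r * q * l ^ 2)) := by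
    intro e he
    have h3 : ∀ f : Fin r → α,
        Real.exp (l * ((Finset.univ.filter fun i => R (f i) e).card - K)) =
        Real.exp (-(l * K)) * ∏ i, if R (f i) e then Real.exp l else 1 := by
      intro f
      rw [Finset.prod_ite, Finset.prod_const, Finset.prod_const_one, mul_one, ← Real.exp_nat_mul,
        ← Real.exp_add]
      congr 1
      ring
    have h4 : ∑ x ∈ P, (if R x e then Real.exp l else 1) ≤
        P.card * Real.exp (q * (l + l ^ 2)) := by
      have h5 : ∑ x ∈ P, (if R x e then Real.exp l else 1) =
          P.card + (Real.exp l - 1) * (P.filter fun x => R x e).card := by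
        have : ∀ x, (if R x e then Real.exp l else 1) =
            1 + (Real.exp l - 1) * if R x e then (1 : ℝ) else 0 := by
          intro x; split_ifs <;> ring
        simp only [this]
        rw [Finset.sum_add_distrib, ← Finset.mul_sum, Finset.sum_boole, Finset.sum_const,
          nsmul_eq_mul, mul_one]
      rw [h5]
      have h6 : 0 ≤ Real.exp l - 1 := by linarith [Real.add_one_le_exp l]
      calc (P.card : ℝ) + (Real.exp l - 1) * (P.filter fun x => R x e).card
          ≤ P.card + (l + l ^ 2) * (q * P.card) := by
            gcongr
            exact hq e he
        _ = P.card * (q * (l + l ^ 2) + 1) := by ring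
        _ ≤ _ := by gcongr; exact Real.add_one_le_exp _
    simp only [h3]
    rw [← Finset.mul_sum, hΩ, ← Finset.prod_univ_sum (fun _ => P)
      (fun _ x => if R x e then Real.exp l else 1), Finset.prod_const, Finset.card_univ,
      Fintype.card_fin]
    calc Real.exp (-(l * K)) * (∑ x ∈ P, (if R x e then Real.exp l else 1)) ^ r
        ≤ Real.exp (-(l * K)) * (P.card * Real.exp (q * (l + l ^ 2))) ^ r := by
          gcongr
      _ = P.card ^ r * Real.exp (-(l * K) + r * (q * (l + l ^ 2))) := by
          rw [mul_pow, ← Real.exp_nat_mul, Real.exp_add]; ring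
      -- Here `l * K ≥ r * q * (l + 2 * l ^ 2)` leaves the exponent at most `-(r * q * l ^ 2)`.
      _ ≤ _ := by
          gcongr
          nlinarith [mul_le_mul_of_nonneg_left hK hl0]
  have h3 : (P.card : ℝ) ^ r ≤ E.card * ((P.card : ℝ) ^ r * Real.exp (-(r * q * l ^ 2))) := by
    calc (P.card : ℝ) ^ r = ∑ f ∈ Ω, (1 : ℝ) := by
          rw [Finset.sum_const, hΩ, Fintype.card_piFinset_const]; simp
      _ ≤ ∑ f ∈ Ω, ∑ e ∈ E, _ := Finset.sum_le_sum h1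
      _ = ∑ e ∈ E, ∑ f ∈ Ω, _ := Finset.sum_comm
      _ ≤ ∑ e ∈ E, _ := Finset.sum_le_sum h2
      _ = _ := by rw [Finset.sum_const, nsmul_eq_mul]
  have h4 : (0 : ℝ) < (P.card : ℝ) ^ r := by positivity
  nlinarith

/-- Colouring the points of `ι` independently with `K` colours, many points of each test set
receive the prescribed colour. -/
theorem exists_labelling {ι τ : Type*} [Fintype ι] [DecidableEq ι] {K : ℕ} (hK : 0 < K)
    (T : Finset τ) (A : τ → Finset ι) (g : τ → ι → Fin K) {θ : ℝ} (hθ0 : 0 ≤ θ) (hθ1 : θ ≤ 1)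
    (h : ∑ t ∈ T, Real.exp (-(θ ^ 2 * (A t).card / (4 * K))) < 1) :
    ∃ l : ι → Fin K, ∀ t ∈ T,
      (1 - θ) * (A t).card / K ≤ (((A t).filter fun e => l e = g t e).card : ℝ) := by
  by_contra! hcon
  have hK' : (0 : ℝ) < K := by exact_mod_cast hK
  -- This value minimises the exponent `(s ^ 2 - θ * s) * |A t| / K`, making it `-θ ^ 2 * |A t| / (4
  -- * K)`.
  set s : ℝ := θ / 2 with hs
  have hs0 : 0 ≤ s := by positivity
  have hexp : Real.exp (-s) ≤ 1 - s + s ^ 2 := by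
    have := Real.abs_exp_sub_one_sub_id_le (x := -s)
      (by rw [abs_neg, abs_of_nonneg hs0]; linarith)
    nlinarith [le_abs_self (Real.exp (-s) - 1 - -s)]
  have h1 : ∀ l : ι → Fin K, (1 : ℝ) ≤ ∑ t ∈ T, Real.exp
      (s * ((1 - θ) * (A t).card / K - ((A t).filter fun e => l e = g t e).card)) := by
    intro l
    obtain ⟨t, ht, hlt⟩ := hcon l
    refine le_trans ?_ (Finset.single_le_sum (f := fun t => Real.exp
      (s * ((1 - θ) * (A t).card / K - ((A t).filter fun e => l e = g t e).card)))
      (fun _ _ => Real.exp_nonneg _) ht)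
    exact Real.one_le_exp (mul_nonneg hs0 (by linarith))
  have h2 : ∀ t ∈ T, ∑ l : ι → Fin K, Real.exp
      (s * ((1 - θ) * (A t).card / K - ((A t).filter fun e => l e = g t e).card)) ≤
        (K : ℝ) ^ Fintype.card ι * Real.exp (-(θ ^ 2 * (A t).card / (4 * K))) := by
    intro t _
    set M : ℝ := ((A t).card : ℝ) with hM
    have hM0 : 0 ≤ M := Nat.cast_nonneg _
    have h3 : ∀ l : ι → Fin K,
        Real.exp (s * ((1 - θ) * M / K - ((A t).filter fun e => l e = g t e).card)) =
        Real.exp (s * ((1 - θ) * M / K)) *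
          ∏ e, if e ∈ A t ∧ l e = g t e then Real.exp (-s) else 1 := by
      intro l
      rw [Finset.prod_ite, Finset.prod_const, Finset.prod_const_one, mul_one, ← Real.exp_nat_mul,
        ← Real.exp_add]
      have : (Finset.univ.filter fun e => e ∈ A t ∧ l e = g t e) =
          (A t).filter fun e => l e = g t e := by
        ext e; simp
      rw [this]
      congr 1
      ring
    have h4 : ∀ e : ι, ∑ x : Fin K, (if e ∈ A t ∧ x = g t e then Real.exp (-s) else 1) ≤
        K * if e ∈ A t then Real.exp (-((s - s ^ 2) / K)) else 1 := by
      intro e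
      by_cases he : e ∈ A t
      · simp only [he, true_and, if_true]
        have : ∀ x, (if x = g t e then Real.exp (-s) else 1) =
            1 + if x = g t e then Real.exp (-s) - 1 else 0 := by
          intro x; split_ifs <;> ring
        simp only [this]
        rw [Finset.sum_add_distrib, Finset.sum_ite_eq', if_pos (Finset.mem_univ _),
          Finset.sum_const, Finset.card_univ, Fintype.card_fin, nsmul_eq_mul, mul_one]
        calc (K : ℝ) + (Real.exp (-s) - 1) ≤ K * (-((s - s ^ 2) / K) + 1) := by
              field_simp
              linarith
          _ ≤ _ := by gcongr; exact Real.add_one_le_exp _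
      · simp [he]
    simp only [h3]
    rw [← Finset.mul_sum, ← Fintype.piFinset_univ, ← Finset.prod_univ_sum (fun _ => Finset.univ)
      (fun e x => if e ∈ A t ∧ x = g t e then Real.exp (-s) else 1)]
    calc Real.exp (s * ((1 - θ) * M / K)) *
          ∏ e, ∑ x : Fin K, (if e ∈ A t ∧ x = g t e then Real.exp (-s) else 1)
        ≤ Real.exp (s * ((1 - θ) * M / K)) *
          ∏ e, (K * if e ∈ A t then Real.exp (-((s - s ^ 2) / K)) else 1) := by
          gcongr with e
          exact h4 e
      _ = K ^ Fintype.card ι *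
          Real.exp (s * ((1 - θ) * M / K) + M * (-((s - s ^ 2) / K))) := by
          rw [Finset.prod_mul_distrib, Finset.prod_const, Finset.card_univ, Finset.prod_ite,
            Finset.prod_const, Finset.prod_const_one, mul_one, ← Real.exp_nat_mul,
            Finset.filter_univ_mem, Real.exp_add]
          ring
      _ = _ := by
          congr 2
          simp only [hs]
          field_simp
          ring
  have h3 : (K : ℝ) ^ Fintype.card ι ≤
      (K : ℝ) ^ Fintype.card ι * ∑ t ∈ T, Real.exp (-(θ ^ 2 * (A t).card / (4 * K))) := by
    calc (K : ℝ) ^ Fintype.card ι = ∑ l : ι → Fin K, (1 : ℝ) := by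
          rw [Finset.sum_const, Finset.card_univ, Fintype.card_fun, Fintype.card_fin]; simp
      _ ≤ ∑ l : ι → Fin K, ∑ t ∈ T, _ := Finset.sum_le_sum fun l _ => h1 l
      _ = ∑ t ∈ T, ∑ l : ι → Fin K, _ := Finset.sum_comm
      _ ≤ ∑ t ∈ T, _ := Finset.sum_le_sum h2
      _ = _ := by rw [Finset.mul_sum]
  have h4 : (0 : ℝ) < (K : ℝ) ^ Fintype.card ι := by positivity
  nlinarith

/-- A union bound over pairs of sets of total size greater than `N`. -/
theorem sum_exp_neg_card_mul_card_le (N : ℕ) {c : ℝ} (hc : 0 ≤ c)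
    (hy : 2 * N * Real.exp (-(c * N / 4)) ≤ 1) :
    ∑ x ∈ (Finset.univ : Finset (Finset (Fin N) × Finset (Fin N))).filter
        (fun x => N < x.1.card + x.2.card),
      Real.exp (-(c * x.1.card * x.2.card)) ≤ 8 * N * Real.exp (-(c * N / 4)) := by
  set y := Real.exp (-(c * N / 4)) with hydef
  have hy0 : 0 < y := Real.exp_pos _
  have h1 : ∑ S : Finset (Fin N), y ^ S.card = (1 + y) ^ N := by
    have := Finset.prod_one_add (s := (Finset.univ : Finset (Fin N))) (f := fun _ => y)
    simpa using this.symm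
  have h2 : ∑ S : Finset (Fin N), y ^ Sᶜ.card = (1 + y) ^ N := by
    rw [← h1]
    exact Function.Bijective.sum_comp compl_bijective fun S : Finset (Fin N) => y ^ S.card
  have h3 : (1 + y) ^ N * (1 + y) ^ N - 1 ≤ 4 * N * y := by
    have e1 : (1 + y) ^ N * (1 + y) ^ N ≤ Real.exp (2 * N * y) := by
      rw [← pow_add]
      calc (1 + y) ^ (N + N) ≤ (Real.exp y) ^ (N + N) := by
            gcongr
            linarith [Real.add_one_le_exp y]
        _ = _ := by
            rw [← Real.exp_nat_mul]; congr 1; push_cast; ring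
    have hx0 : 0 ≤ 2 * N * y := by positivity
    have e2 := Real.abs_exp_sub_one_sub_id_le (x := 2 * N * y) (by rwa [abs_of_nonneg hx0])
    nlinarith [le_abs_self (Real.exp (2 * N * y) - 1 - 2 * N * y)]
  -- Over all pairs the sum factors as `(1 + y) ^ (2 * N)`. Its term 1 comes from the pair `(∅,
  -- univ)`, whose sizes add up to exactly `N`; the strict inequality in the statement excludes it.
  have h4 : ∑ x ∈ (Finset.univ : Finset (Finset (Fin N) × Finset (Fin N))).erase
      (∅, Finset.univ), y ^ x.1.card * y ^ x.2ᶜ.card ≤ 4 * N * y := by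
    have := Finset.add_sum_erase (Finset.univ : Finset (Finset (Fin N) × Finset (Fin N)))
      (fun x => y ^ x.1.card * y ^ x.2ᶜ.card) (Finset.mem_univ (∅, Finset.univ))
    rw [Fintype.sum_prod_type] at this
    dsimp only at this
    rw [← Finset.sum_mul_sum, h1, h2] at this
    simp only [Finset.card_empty, Finset.compl_univ, pow_zero, mul_one] at this
    linarith
  have h5 : ∑ x ∈ (Finset.univ : Finset (Finset (Fin N) × Finset (Fin N))).erase
      (Finset.univ, ∅), y ^ x.1ᶜ.card * y ^ x.2.card ≤ 4 * N * y := by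
    have := Finset.add_sum_erase (Finset.univ : Finset (Finset (Fin N) × Finset (Fin N)))
      (fun x => y ^ x.1ᶜ.card * y ^ x.2.card) (Finset.mem_univ (Finset.univ, ∅))
    rw [Fintype.sum_prod_type] at this
    dsimp only at this
    rw [← Finset.sum_mul_sum, h1, h2] at this
    simp only [Finset.card_empty, Finset.compl_univ, pow_zero, mul_one] at this
    linarith
  have hcompl : ∀ S : Finset (Fin N), (Sᶜ.card : ℝ) = N - S.card := by
    intro S
    rw [Finset.card_compl, Fintype.card_fin, Nat.cast_sub]
    simpa using Finset.card_le_univ S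
  have hcard : ∀ S : Finset (Fin N), (S.card : ℝ) ≤ N := by
    intro S
    simpa using (Nat.cast_le (α := ℝ)).2 (Finset.card_le_univ S)
  have hpow : ∀ m m' : ℕ, y ^ m * y ^ m' = Real.exp (-(c * (N / 4 * (m + m')))) := by
    intro m m'
    rw [hydef, ← Real.exp_nat_mul, ← Real.exp_nat_mul, ← Real.exp_add]
    congr 1
    ring
  -- One of the sets, say `T`, has at least `N / 2` elements. Since `|Tᶜ| ≤ |S|`, the product `|S| *
  -- |T|` is at least `N / 4 * (|S| + |Tᶜ|)`.
  have key : ∀ x ∈ (Finset.univ : Finset (Finset (Fin N) × Finset (Fin N))).filter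
      (fun x => N < x.1.card + x.2.card), Real.exp (-(c * x.1.card * x.2.card)) ≤
        y ^ x.1.card * y ^ x.2ᶜ.card + y ^ x.1ᶜ.card * y ^ x.2.card := by
    rintro ⟨S, T⟩ hx
    simp only [Finset.mem_filter, Finset.mem_univ, true_and] at hx ⊢
    have hx' : (N : ℝ) ≤ S.card + T.card := by exact_mod_cast hx.le
    have hs0 : (0 : ℝ) ≤ S.card := Nat.cast_nonneg _
    have ht0 : (0 : ℝ) ≤ T.card := Nat.cast_nonneg _
    rw [hpow, hpow, hcompl, hcompl, mul_assoc]
    rcases le_total (N : ℝ) (2 * T.card) with hT | hT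
    · refine le_add_of_le_of_nonneg (Real.exp_le_exp.2 (neg_le_neg ?_)) (Real.exp_nonneg _)
      refine mul_le_mul_of_nonneg_left ?_ hc
      nlinarith [mul_le_mul_of_nonneg_left hT hs0]
    · refine le_add_of_nonneg_of_le (Real.exp_nonneg _) (Real.exp_le_exp.2 (neg_le_neg ?_))
      refine mul_le_mul_of_nonneg_left ?_ hc
      have hS : (N : ℝ) ≤ 2 * S.card := by linarith
      nlinarith [mul_le_mul_of_nonneg_left hS ht0]
  refine (Finset.sum_le_sum key).trans ?_
  rw [Finset.sum_add_distrib]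
  have hsub : ∀ z : Finset (Fin N) × Finset (Fin N), z.1.card + z.2.card ≤ N →
      (Finset.univ : Finset (Finset (Fin N) × Finset (Fin N))).filter
        (fun x => N < x.1.card + x.2.card) ⊆ Finset.univ.erase z := by
    intro z hz x hx
    rw [Finset.mem_filter] at hx
    refine Finset.mem_erase.2 ⟨?_, Finset.mem_univ _⟩
    rintro rfl
    omega
  have h6 := (Finset.sum_le_sum_of_subset_of_nonneg (hsub (∅, Finset.univ) (by simp))
    (fun x _ _ => by positivity)).trans h4
  have h7 := (Finset.sum_le_sum_of_subset_of_nonneg (hsub (Finset.univ, ∅) (by simp))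
    (fun x _ _ => by positivity)).trans h5
  linarith

end Sampling

/-! ### Block systems and the bipartite graphs they define. -/

/-- A partition of `n` points into `N` blocks of size `a` and `N` blocks of size `b`. -/
structure BlockSystem (n N a b : ℕ) where
  /-- The blocks of size `a`. -/
  left : Fin N → Finset (Fin n)
  /-- The blocks of size `b`. -/
  right : Fin N → Finset (Fin n)
  card_left : ∀ i, (left i).card = a
  card_right : ∀ i, (right i).card = b
  disjoint_left : ∀ i j, i ≠ j → Disjoint (left i) (left j)
  disjoint_right : ∀ i j, i ≠ j → Disjoint (right i) (right j)
  disjoint_left_right : ∀ i j, Disjoint (left i) (right j)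
  cover : ∀ v, (∃ i, v ∈ left i) ∨ ∃ i, v ∈ right i

namespace BlockSystem

variable {n N a b : ℕ}

theorem nonempty_of_eq (h : n = N * (a + b)) : Nonempty (BlockSystem n N a b) := by
  subst h
  let φ : Fin N × Fin (a + b) ≃ Fin (N * (a + b)) := finProdFinEquiv
  let bl : (Fin (a + b) → Prop) → Fin N → Finset (Fin (N * (a + b))) := fun Q i => by
    classical exact Finset.univ.filter fun v => (φ.symm v).1 = i ∧ Q (φ.symm v).2
  have hcard : ∀ (m : ℕ) (Q : Fin (a + b) → Prop) (i : Fin N) (e : Fin m → Fin (a + b)),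
      Function.Injective e → (∀ x, Q x ↔ ∃ y, e y = x) → (bl Q i).card = m := by
    intro m Q i e he hQ
    rw [← Fintype.card_fin m, ← Finset.card_univ,
      ← Finset.card_image_of_injective (f := fun y => φ (i, e y)) Finset.univ
        (fun y y' h => by simpa using he (by simpa using h))]
    congr 1
    ext v
    simp only [bl, Finset.mem_filter, Finset.mem_univ, true_and, Finset.mem_image, hQ]
    constructor
    · rintro ⟨rfl, y, hy⟩
      exact ⟨y, by rw [hy]; simp⟩
    · rintro ⟨y, rfl⟩
      simp
  refine ⟨⟨bl fun x => x.1 < a, bl fun x => ¬ x.1 < a, fun i => ?_, fun i => ?_, ?_, ?_, ?_,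
    ?_⟩⟩
  · refine hcard a (fun x => x.1 < a) i (Fin.castAdd b) (Fin.castAdd_injective a b) fun x => ⟨fun h => ?_, ?_⟩
    · exact ⟨⟨x.1, h⟩, rfl⟩
    · rintro ⟨y, rfl⟩
      simp
  · refine hcard b (fun x => ¬ x.1 < a) i (Fin.natAdd a) (Fin.natAdd_injective b a) fun x => ⟨fun h => ?_, ?_⟩
    · exact ⟨⟨x.1 - a, by omega⟩, Fin.ext (by simp; omega)⟩
    · rintro ⟨y, rfl⟩
      simp
  · intro i j hij
    rw [Finset.disjoint_left]
    intro v hv hv'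
    simp only [bl, Finset.mem_filter] at hv hv'
    exact hij (hv.2.1.symm.trans hv'.2.1)
  · intro i j hij
    rw [Finset.disjoint_left]
    intro v hv hv'
    simp only [bl, Finset.mem_filter] at hv hv'
    exact hij (hv.2.1.symm.trans hv'.2.1)
  · intro i j
    rw [Finset.disjoint_left]
    intro v hv hv'
    simp only [bl, Finset.mem_filter] at hv hv'
    exact hv'.2.2 hv.2.2
  · intro v
    by_cases h : ((φ.symm v).2 : ℕ) < a
    · exact Or.inl ⟨(φ.symm v).1, by simp [bl, h]⟩
    · exact Or.inr ⟨(φ.symm v).1, by simp only [bl, Finset.mem_filter]; simp [h]⟩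

variable (P : BlockSystem n N a b)

/-- The set formed by a left block and a right block, moved by the permutation `σ`. -/
def edge (σ : Equiv.Perm (Fin n)) (x : Fin N × Fin N) : Finset (Fin n) :=
  (P.left x.1 ∪ P.right x.2).map σ.toEmbedding

theorem card_edge (σ : Equiv.Perm (Fin n)) (x : Fin N × Fin N) : (P.edge σ x).card = a + b := by
  rw [edge, Finset.card_map, Finset.card_union_of_disjoint (P.disjoint_left_right _ _),
    P.card_left, P.card_right]

/-- A point of a nonempty block determines that block, so the union of two blocks determines both.
Hence edges of the bipartite graph may be counted as edges of the hypergraph. -/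
theorem edge_injective (ha : 0 < a) (hb : 0 < b) (σ : Equiv.Perm (Fin n)) :
    Function.Injective (P.edge σ) := by
  rintro ⟨i, j⟩ ⟨i', j'⟩ h
  have h' : P.left i ∪ P.right j = P.left i' ∪ P.right j' := Finset.map_injective _ h
  obtain ⟨v, hv⟩ : (P.left i).Nonempty := by rw [← Finset.card_pos, P.card_left]; exact ha
  obtain ⟨w, hw⟩ : (P.right j).Nonempty := by rw [← Finset.card_pos, P.card_right]; exact hb
  have hv' : v ∈ P.left i' ∪ P.right j' := h' ▸ Finset.mem_union_left _ hv
  have hw' : w ∈ P.left i' ∪ P.right j' := h' ▸ Finset.mem_union_right _ hw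
  have hi : i = i' := by
    by_contra hne
    rcases Finset.mem_union.1 hv' with h1 | h1
    · exact Finset.disjoint_left.1 (P.disjoint_left i i' hne) hv h1
    · exact Finset.disjoint_left.1 (P.disjoint_left_right i j') hv h1
  have hj : j = j' := by
    by_contra hne
    rcases Finset.mem_union.1 hw' with h1 | h1
    · exact Finset.disjoint_left.1 (P.disjoint_left_right i' j) h1 hw
    · exact Finset.disjoint_left.1 (P.disjoint_right j j' hne) hw h1
  rw [hi, hj]

variable {k : ℕ} (H : UniformHypergraph (Fin n) k)

/-- The bipartite graph between moved left blocks and moved right blocks whose edges are the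
pairs that form an edge of `H`. -/
def graph (σ : Equiv.Perm (Fin n)) : Finset (Fin N × Fin N) :=
  Finset.univ.filter fun x => P.edge σ x ∈ H.edges

theorem mem_graph_iff_right (hk : a + b = k) (σ : Equiv.Perm (Fin n)) (i j : Fin N) :
    (i, j) ∈ P.graph H σ ↔
      (P.right j).map σ.toEmbedding ∈ H.nbhd ((P.left i).map σ.toEmbedding) := by
  simp only [graph, edge, UniformHypergraph.nbhd, Finset.mem_filter, Finset.mem_univ, true_and,
    Finset.mem_powersetCard, Finset.subset_univ, Finset.card_map, P.card_left, P.card_right,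
    Finset.map_union]
  exact ⟨fun h => ⟨by omega, h⟩, fun h => h.2⟩

theorem mem_graph_iff_left (hk : a + b = k) (σ : Equiv.Perm (Fin n)) (i j : Fin N) :
    (i, j) ∈ P.graph H σ ↔
      (P.left i).map σ.toEmbedding ∈ H.nbhd ((P.right j).map σ.toEmbedding) := by
  simp only [graph, edge, UniformHypergraph.nbhd, Finset.mem_filter, Finset.mem_univ, true_and,
    Finset.mem_powersetCard, Finset.subset_univ, Finset.card_map, P.card_left, P.card_right,
    Finset.map_union, Finset.union_comm ((P.left i).map _)]
  exact ⟨fun h => ⟨by omega, h⟩, fun h => h.2⟩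

/-- The perfect matching of the hypergraph given by a perfect matching of the bipartite graph. -/
def matching (σ : Equiv.Perm (Fin n)) (τ : Fin N ≃ Fin N) : Finset (Finset (Fin n)) :=
  Finset.univ.image fun i => P.edge σ (i, τ i)

theorem isPerfectMatching_matching (σ : Equiv.Perm (Fin n)) (τ : Fin N ≃ Fin N)
    (h : ∀ i, P.edge σ (i, τ i) ∈ H.edges) : H.IsPerfectMatching (P.matching σ τ) := by
  have hmem : ∀ v x, v ∈ P.edge σ x ↔ σ.symm v ∈ P.left x.1 ∨ σ.symm v ∈ P.right x.2 := by
    intro v x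
    rw [edge, Finset.mem_map_equiv, Finset.mem_union]
  refine ⟨?_, fun v => ?_⟩
  · intro e he
    obtain ⟨i, -, rfl⟩ := Finset.mem_image.1 he
    exact h i
  · have huniq : ∃ i, v ∈ P.edge σ (i, τ i) ∧ ∀ i', v ∈ P.edge σ (i', τ i') → i' = i := by
      simp only [hmem]
      rcases P.cover (σ.symm v) with ⟨i, hi⟩ | ⟨j, hj⟩
      · refine ⟨i, Or.inl hi, fun i' hi' => ?_⟩
        by_contra hne
        rcases hi' with h1 | h1
        · exact Finset.disjoint_left.1 (P.disjoint_left _ _ hne) h1 hi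
        · exact Finset.disjoint_left.1 (P.disjoint_left_right _ _) hi h1
      · refine ⟨τ.symm j, Or.inr (by simpa using hj), fun i' hi' => ?_⟩
        by_contra hne
        rcases hi' with h1 | h1
        · exact Finset.disjoint_left.1 (P.disjoint_left_right _ _) h1 hj
        · refine Finset.disjoint_left.1 (P.disjoint_right _ _ fun hh => hne ?_) h1 hj
          rw [← hh, Equiv.symm_apply_apply]
    obtain ⟨i, hi, hi'⟩ := huniq
    refine ⟨P.edge σ (i, τ i), ⟨Finset.mem_image_of_mem _ (Finset.mem_univ i), hi⟩, ?_⟩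
    rintro e ⟨he, hv⟩
    obtain ⟨i', -, rfl⟩ := Finset.mem_image.1 he
    rw [hi' i' hv]

/-- Edge-disjoint subgraphs of the bipartite graphs of several permutations, each of which
satisfies the cut condition, give many edge-disjoint perfect matchings. -/
theorem exists_packing (ha : 0 < a) (hb : 0 < b) (hN : 0 < N) {r s : ℕ}
    (f : Fin r → Equiv.Perm (Fin n)) (G : Fin r → Finset (Fin N × Fin N))
    (hG : ∀ i, ∀ x ∈ G i, P.edge (f i) x ∈ H.edges)
    (hdisj : ∀ i j, i ≠ j → ∀ x ∈ G i, ∀ y ∈ G j, P.edge (f i) x ≠ P.edge (f j) y)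
    (hcut : ∀ i (S T : Finset (Fin N)),
      s * (S.card + T.card) ≤ s * N + (edgesBetween (G i) S T).card) :
    ∃ C : Finset (Finset (Finset (Fin n))), H.IsPerfectMatchingPacking C ∧ C.card = r * s := by
  have hex : ∀ i, ∃ τ : Fin s → (Fin N ≃ Fin N), (∀ j x, (x, τ j x) ∈ G i) ∧
      ∀ j j', j ≠ j' → ∀ x, τ j x ≠ τ j' x := fun i =>
    exists_disjoint_matchings (G i) s rfl (by simpa using hcut i)
  choose τ hτ hne using hex
  have hd : ∀ p q : Fin r × Fin s, p ≠ q →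
      Disjoint (P.matching (f p.1) (τ p.1 p.2)) (P.matching (f q.1) (τ q.1 q.2)) := by
    rintro ⟨i, j⟩ ⟨i', j'⟩ hpq
    rw [Finset.disjoint_left]
    intro e he he'
    obtain ⟨x, -, rfl⟩ := Finset.mem_image.1 he
    obtain ⟨y, -, hy⟩ := Finset.mem_image.1 he'
    dsimp only at hy
    by_cases hii : i = i'
    · subst hii
      have h1 := P.edge_injective ha hb (f i) hy
      simp only [Prod.mk.injEq] at h1
      obtain ⟨rfl, h2⟩ := h1
      exact hne i j j' (fun h => hpq (by rw [h])) y h2.symm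
    · exact hdisj i i' hii _ (hτ i j x) _ (hτ i' j' y) hy.symm
  -- Disjoint matchings are distinct only because they are nonempty; the count `r * s` depends on
  -- this.
  have hnonempty : ∀ p : Fin r × Fin s, (P.matching (f p.1) (τ p.1 p.2)).Nonempty := fun p =>
    ⟨_, Finset.mem_image_of_mem _ (Finset.mem_univ (⟨0, hN⟩ : Fin N))⟩
  have hinj : Function.Injective fun p : Fin r × Fin s => P.matching (f p.1) (τ p.1 p.2) := by
    intro p q hpq
    by_contra hne'
    have h1 := hd p q hne'
    dsimp only at hpq
    rw [← hpq, disjoint_self] at h1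
    exact (hnonempty p).ne_empty h1
  refine ⟨Finset.univ.image fun p : Fin r × Fin s => P.matching (f p.1) (τ p.1 p.2), ⟨?_, ?_⟩, ?_⟩
  · intro M hM
    obtain ⟨p, -, rfl⟩ := Finset.mem_image.1 hM
    exact P.isPerfectMatching_matching H _ _ fun x => hG _ _ (hτ p.1 p.2 x)
  · intro M hM M' hM' hMM
    obtain ⟨p, -, rfl⟩ := Finset.mem_image.1 hM
    obtain ⟨q, -, rfl⟩ := Finset.mem_image.1 hM'
    exact hd p q fun h => hMM (by rw [h])
  · rw [Finset.card_image_of_injective _ hinj, Finset.card_univ, Fintype.card_prod,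
      Fintype.card_fin, Fintype.card_fin]

end BlockSystem

/-! ### Most permutations are balanced. -/

theorem one_sub_mul_choose_le_choose_sub {n s c k : ℕ} (hn : 0 < n) (hk : s + c ≤ k)
    (hkn : k ≤ n) :
    (1 - (k : ℝ) ^ 2 / n) * n.choose c ≤ (n - s).choose c := by
  have hn' : (0 : ℝ) < n := by exact_mod_cast hn
  have hkn' : (k : ℝ) ≤ n := by exact_mod_cast hkn
  have hck : (c : ℝ) ≤ k := by exact_mod_cast (by omega : c ≤ k)
  have hc : (0 : ℝ) < c.factorial := by exact_mod_cast c.factorial_pos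
  have h1 : (n.descFactorial c : ℝ) = c.factorial * n.choose c := by
    exact_mod_cast Nat.descFactorial_eq_factorial_mul_choose n c
  have h2 : ((n - s).descFactorial c : ℝ) = c.factorial * (n - s).choose c := by
    exact_mod_cast Nat.descFactorial_eq_factorial_mul_choose (n - s) c
  have h3 : (n.descFactorial c : ℝ) ≤ n ^ c := by exact_mod_cast Nat.descFactorial_le_pow n c
  have h4 : ((n : ℝ) - k) ^ c ≤ (n - s).descFactorial c := by
    have h5 : (n - k) ^ c ≤ (n - s).descFactorial c :=
      (Nat.pow_le_pow_left (by omega) c).trans (Nat.pow_sub_le_descFactorial (n - s) c)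
    calc ((n : ℝ) - k) ^ c = (((n - k) ^ c : ℕ) : ℝ) := by push_cast [Nat.cast_sub hkn]; rfl
      _ ≤ _ := by exact_mod_cast h5
  -- Bernoulli's inequality. The two falling factorials lie between `(n - k) ^ c` and `n ^ c`.
  have h5 : (1 - (k : ℝ) ^ 2 / n) * n ^ c ≤ ((n : ℝ) - k) ^ c := by
    have h6 : (1 : ℝ) + c * (-(k / n)) ≤ (1 + -(k / n)) ^ c := by
      refine one_add_mul_le_pow ?_ c
      have : (k : ℝ) / n ≤ 1 := (div_le_one hn').2 hkn'
      linarith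
    have h7 : 1 - (k : ℝ) ^ 2 / n ≤ 1 + c * (-(k / n)) := by
      have : (c : ℝ) * (k / n) ≤ k * (k / n) := by gcongr
      have e : (k : ℝ) * (k / n) = k ^ 2 / n := by ring
      linarith
    calc (1 - (k : ℝ) ^ 2 / n) * n ^ c ≤ (1 + -((k : ℝ) / n)) ^ c * n ^ c := by
          gcongr
          exact h7.trans h6
      _ = _ := by
          rw [← mul_pow]
          congr 1
          field_simp
          ring
  rcases le_total (1 - (k : ℝ) ^ 2 / n) 0 with h0 | h0
  · exact (mul_nonpos_of_nonpos_of_nonneg h0 (Nat.cast_nonneg _)).trans (Nat.cast_nonneg _)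
  · refine le_of_mul_le_mul_left ?_ hc
    calc (c.factorial : ℝ) * ((1 - (k : ℝ) ^ 2 / n) * n.choose c)
        = (1 - (k : ℝ) ^ 2 / n) * n.descFactorial c := by rw [h1]; ring
      _ ≤ (1 - (k : ℝ) ^ 2 / n) * n ^ c := by gcongr
      _ ≤ _ := h5.trans (h4.trans h2.le)

namespace UniformHypergraph

section Density

variable {V : Type*} [Fintype V] [DecidableEq V] {k : ℕ} (H : UniformHypergraph V k)

theorem density_nonneg : 0 ≤ H.density := by unfold density; positivity

theorem numEdges_le_choose : H.numEdges ≤ (Fintype.card V).choose k := by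
  rw [numEdges, ← Finset.card_univ, ← Finset.card_powersetCard]
  exact Finset.card_le_card fun e he =>
    Finset.mem_powersetCard.2 ⟨Finset.subset_univ e, H.sized he⟩

theorem density_le_one : H.density ≤ 1 :=
  div_le_one_of_le₀ (by exact_mod_cast H.numEdges_le_choose) (Nat.cast_nonneg _)

theorem card_of_mem_nbhd {X Y : Finset V} (h : Y ∈ H.nbhd X) : Y.card = k - X.card :=
  (Finset.mem_powersetCard.1 (Finset.mem_filter.1 h).1).2

end Density

variable {n N k : ℕ} (H : UniformHypergraph (Fin n) k)

/-- With respect to the blocks `D` moved by `σ`, all sets of size `s` have large degree and all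
pairs of disjoint sets of size `s` have small codegree. -/
def IsBalancedFor (ε : ℝ) (s : ℕ) (D : Fin N → Finset (Fin n)) (σ : Equiv.Perm (Fin n)) : Prop :=
  (∀ S : Finset (Fin n), S.card = s →
    (1 - 2 * ε) * H.density * N ≤ blockCount D (H.nbhd S) σ) ∧
  ∀ S₁ S₂ : Finset (Fin n), S₁.card = s → S₂.card = s → Disjoint S₁ S₂ →
    (blockCount D (H.nbhd S₁ ∩ H.nbhd S₂) σ : ℝ) ≤ (1 + 2 * ε) * H.density ^ 2 * N

-- The mean block counts are governed by the degree and codegree conditions, and a deviation of `ε *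
-- p ^ 2 * N / 2` fits into the doubled error `2 * ε` in both cases. The tail bound is then summed
-- over all sets and all disjoint pairs, at most `n ^ (2 * k)` events of each kind.
open Classical in
theorem card_not_isBalancedFor_le {ε : ℝ} {s c : ℕ} (hn : 0 < n) (hk : s + c = k) (hkn : k ≤ n)
    (hε : 0 ≤ ε) (hε1 : ε ≤ 1) (hkε : (k : ℝ) ^ 2 / n ≤ ε / 2) (hmin : H.MinDegreeCond ε s)
    (hco : H.CodegreeCond ε s) (D : Fin N → Finset (Fin n)) (hDc : ∀ j, (D j).card = c)
    (hD : ∀ i j, i ≠ j → Disjoint (D i) (D j)) :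
    ((Finset.univ.filter fun σ => ¬ H.IsBalancedFor ε s D σ).card : ℝ) ≤
      2 * n ^ (2 * k) *
        (n.factorial * Real.exp (-((ε * H.density ^ 2 * N / 2) ^ 2 / (32 * n)))) := by
  set p := H.density with hp
  have hp0 : 0 ≤ p := H.density_nonneg
  have hp1 : p ≤ 1 := H.density_le_one
  set t : ℝ := ε * p ^ 2 * N / 2 with ht
  have ht0 : 0 ≤ t := by positivity
  have hn1 : (1 : ℝ) ≤ n := by exact_mod_cast hn
  have hchoose : (0 : ℝ) < n.choose c := by exact_mod_cast Nat.choose_pos (by omega)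
  set X := (n.factorial : ℝ) * Real.exp (-(t ^ 2 / (32 * n))) with hX
  have hX0 : 0 ≤ X := by positivity
  set 𝒮 := Finset.powersetCard s (Finset.univ : Finset (Fin n)) with hS
  set 𝒬 := (𝒮 ×ˢ 𝒮).filter fun x => Disjoint x.1 x.2 with hP
  have hScard : 𝒮.card ≤ n ^ s := by
    rw [hS, Finset.card_powersetCard, Finset.card_univ, Fintype.card_fin]
    exact Nat.choose_le_pow n s
  have h1 : ∀ S ∈ 𝒮, ((Finset.univ.filter fun σ =>
      (blockCount D (H.nbhd S) σ : ℝ) ≤ (1 - 2 * ε) * p * N).card : ℝ) ≤ X := by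
    intro S hSm
    have hSc : S.card = s := (Finset.mem_powersetCard.1 hSm).2
    refine card_blockCount_le_le hn D hD _ c hDc
      (fun T hT => by rw [H.card_of_mem_nbhd hT]; omega) ht0 ?_
    have hdeg : (1 - ε) * (n - s).choose c * p ≤ ((H.nbhd S).card : ℝ) := by
      have h2 := hmin S hSc
      rw [Int.ceil_le, Fintype.card_fin, show k - s = c by omega] at h2
      exact_mod_cast h2
    have hratio := one_sub_mul_choose_le_choose_sub (s := s) (c := c) hn hk.le hkn
    have h3 : (1 - ε) * (1 - ε / 2) * p * n.choose c ≤ (H.nbhd S).card := by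
      refine le_trans ?_ hdeg
      have h4 : (1 - ε / 2) * n.choose c ≤ (n - s).choose c := by
        refine le_trans ?_ hratio
        gcongr
      have h5 := mul_le_mul_of_nonneg_left h4 (mul_nonneg (sub_nonneg.2 hε1) hp0)
      linarith
    have h4 : N * ((1 - ε) * (1 - ε / 2) * p) ≤ N * (H.nbhd S).card / n.choose c := by
      rw [le_div_iff₀ hchoose]
      have := mul_le_mul_of_nonneg_left h3 (Nat.cast_nonneg (α := ℝ) N)
      linarith
    refine le_trans ?_ (sub_le_sub_right h4 t)
    have h5 : t ≤ ε / 2 * (p * N) := by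
      have : p ^ 2 * N ≤ p * N := by
        gcongr
        nlinarith
      have := mul_le_mul_of_nonneg_left this hε
      rw [ht]; linarith
    have h6 : 0 ≤ ε ^ 2 * (p * N) := by positivity
    nlinarith
  have h2 : ∀ x ∈ 𝒬, ((Finset.univ.filter fun σ => (1 + 2 * ε) * p ^ 2 * N ≤
      (blockCount D (H.nbhd x.1 ∩ H.nbhd x.2) σ : ℝ)).card : ℝ) ≤ X := by
    intro x hx
    rw [hP, Finset.mem_filter, Finset.mem_product] at hx
    have hx1 : x.1.card = s := (Finset.mem_powersetCard.1 hx.1.1).2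
    have hx2 : x.2.card = s := (Finset.mem_powersetCard.1 hx.1.2).2
    refine card_blockCount_ge_le hn D hD _ c hDc
      (fun T hT => by rw [H.card_of_mem_nbhd (Finset.mem_inter.1 hT).1]; omega) ht0 ?_
    have hcodeg : ((H.nbhd x.1 ∩ H.nbhd x.2).card : ℝ) ≤ (1 + ε) * n.choose c * p ^ 2 := by
      have h2 := hco x.1 x.2 hx1 hx2 hx.2
      rw [Int.le_floor, Fintype.card_fin, show k - s = c by omega] at h2
      have h3 : ((n - 2 * s).choose c : ℝ) ≤ n.choose c := by
        exact_mod_cast Nat.choose_le_choose c (by omega)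
      calc ((H.nbhd x.1 ∩ H.nbhd x.2).card : ℝ) ≤ (1 + ε) * (n - 2 * s).choose c * p ^ 2 := by
            exact_mod_cast h2
        _ ≤ _ := by gcongr
    have h4 : N * (H.nbhd x.1 ∩ H.nbhd x.2).card / n.choose c ≤ N * ((1 + ε) * p ^ 2) := by
      rw [div_le_iff₀ hchoose]
      have := mul_le_mul_of_nonneg_left hcodeg (Nat.cast_nonneg (α := ℝ) N)
      linarith
    refine (add_le_add_left h4 t).trans ?_
    have : 0 ≤ ε * p ^ 2 * N := by positivity
    rw [ht]
    linarith
  have hsub : (Finset.univ.filter fun σ => ¬ H.IsBalancedFor ε s D σ) ⊆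
      (𝒮.biUnion fun S => Finset.univ.filter fun σ =>
        (blockCount D (H.nbhd S) σ : ℝ) ≤ (1 - 2 * ε) * p * N) ∪
      (𝒬.biUnion fun x => Finset.univ.filter fun σ => (1 + 2 * ε) * p ^ 2 * N ≤
        (blockCount D (H.nbhd x.1 ∩ H.nbhd x.2) σ : ℝ)) := by
    intro σ hσ
    by_contra hcon
    simp only [Finset.mem_union, Finset.mem_biUnion, Finset.mem_filter, Finset.mem_univ,
      true_and, not_or, not_exists, not_and, not_le] at hcon hσ
    refine hσ ⟨fun S hSc => (hcon.1 S ?_).le, fun S₁ S₂ hS₁ hS₂ hd => (hcon.2 (S₁, S₂) ?_).le⟩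
    · exact Finset.mem_powersetCard.2 ⟨Finset.subset_univ _, hSc⟩
    · exact Finset.mem_filter.2 ⟨Finset.mem_product.2
        ⟨Finset.mem_powersetCard.2 ⟨Finset.subset_univ _, hS₁⟩,
          Finset.mem_powersetCard.2 ⟨Finset.subset_univ _, hS₂⟩⟩, hd⟩
  have hbi1 : ((𝒮.biUnion fun S => Finset.univ.filter fun σ =>
        (blockCount D (H.nbhd S) σ : ℝ) ≤ (1 - 2 * ε) * p * N).card : ℝ) ≤ n ^ (2 * k) * X := by
    refine (Nat.cast_le.2 Finset.card_biUnion_le).trans ?_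
    rw [Nat.cast_sum]
    refine (Finset.sum_le_sum h1).trans ?_
    rw [Finset.sum_const, nsmul_eq_mul]
    gcongr
    calc (𝒮.card : ℝ) ≤ n ^ s := by exact_mod_cast hScard
      _ ≤ n ^ (2 * k) := pow_le_pow_right₀ hn1 (by omega)
  have hbi2 : ((𝒬.biUnion fun x => Finset.univ.filter fun σ => (1 + 2 * ε) * p ^ 2 * N ≤
        (blockCount D (H.nbhd x.1 ∩ H.nbhd x.2) σ : ℝ)).card : ℝ) ≤ n ^ (2 * k) * X := by
    refine (Nat.cast_le.2 Finset.card_biUnion_le).trans ?_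
    rw [Nat.cast_sum]
    refine (Finset.sum_le_sum h2).trans ?_
    rw [Finset.sum_const, nsmul_eq_mul]
    gcongr
    calc (𝒬.card : ℝ) ≤ 𝒮.card * 𝒮.card := by
          exact_mod_cast (Finset.card_filter_le _ _).trans (Finset.card_product _ _).le
      _ ≤ n ^ s * n ^ s := by gcongr <;> exact_mod_cast hScard
      _ = n ^ (2 * s) := by ring
      _ ≤ n ^ (2 * k) := pow_le_pow_right₀ hn1 (by omega)
  calc ((Finset.univ.filter fun σ => ¬ H.IsBalancedFor ε s D σ).card : ℝ)
      ≤ _ := Nat.cast_le.2 ((Finset.card_le_card hsub).trans (Finset.card_union_le _ _))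
    _ ≤ n ^ (2 * k) * X + n ^ (2 * k) * X := by rw [Nat.cast_add]; exact add_le_add hbi1 hbi2
    _ = _ := by ring

end UniformHypergraph

/-! ### From balanced permutations to edge-disjoint bipartite graphs. -/

namespace BlockSystem

variable {n N a b k : ℕ} (P : BlockSystem n N a b) (H : UniformHypergraph (Fin n) k)

/-- Vertices of the bipartite graph are moved blocks, so balance yields degrees and codegrees with
error `2 * ε`. Codegrees are needed for disjoint sets only, and distinct blocks are disjoint. -/
theorem card_edgesBetween_graph_ge (hk : a + b = k) {ε δ : ℝ} (hp : 0 < H.density)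
    (hε : 0 ≤ ε) (hεδ : 4 * ε ≤ δ) (hδ1 : δ ≤ 1) (hεδ2 : 24 * ε ≤ δ ^ 2)
    (hN : 8 ≤ δ ^ 3 * H.density ^ 3 * N) (σ : Equiv.Perm (Fin n))
    (h₁ : H.IsBalancedFor ε a P.right σ) (h₂ : H.IsBalancedFor ε b P.left σ)
    (S T : Finset (Fin N)) (hST : N ≤ S.card + T.card) :
    (1 - δ) * (H.density * S.card * T.card) ≤ ((edgesBetween (P.graph H σ) S T).card : ℝ) := by
  have hl : ∀ i, ((P.left i).map σ.toEmbedding).card = a := fun i => by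
    rw [Finset.card_map, P.card_left]
  have hr : ∀ i, ((P.right i).map σ.toEmbedding).card = b := fun i => by
    rw [Finset.card_map, P.card_right]
  refine card_edgesBetween_ge (P.graph H σ) N (Fintype.card_fin N) (Fintype.card_fin N)
    (ε := 2 * ε) hp (by linarith) (by linarith) hδ1 (by linarith) hN ?_ ?_ ?_ ?_ S T hST
  · intro i
    simp only [P.mem_graph_iff_right H hk]
    exact h₁.1 _ (hl i)
  · intro j
    simp only [P.mem_graph_iff_left H hk]
    exact h₂.1 _ (hr j)
  · intro i i' hii
    have := h₁.2 _ _ (hl i) (hl i') ((Finset.disjoint_map _).2 (P.disjoint_left i i' hii))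
    simpa only [P.mem_graph_iff_right H hk, blockCount, Finset.mem_inter] using this
  · intro j j' hjj
    have := h₂.2 _ _ (hr j) (hr j') ((Finset.disjoint_map _).2 (P.disjoint_right j j' hjj))
    simpa only [P.mem_graph_iff_left H hk, blockCount, Finset.mem_inter] using this

/-- The number of permutations for which a given set is a union of two moved blocks. -/
theorem card_mem_image_edge_le (hk : a + b = k) (hkn : k ≤ n) (e : Finset (Fin n))
    (he : e.card = k) :
    ((Finset.univ.filter fun σ => ∃ x, P.edge σ x = e).card : ℝ) ≤
      N ^ 2 / n.choose k * n.factorial := by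
  have hchoose : (0 : ℝ) < n.choose k := by exact_mod_cast Nat.choose_pos hkn
  have hsub : (Finset.univ.filter fun σ => ∃ x, P.edge σ x = e) ⊆
      (Finset.univ : Finset (Fin N × Fin N)).biUnion fun x =>
        Finset.univ.filter fun σ => P.edge σ x = e := by
    intro σ hσ
    simpa using hσ
  have h1 : ∀ x : Fin N × Fin N,
      ((Finset.univ.filter fun σ => P.edge σ x = e).card : ℝ) = n.factorial / n.choose k := by
    intro x
    have hc : (P.left x.1 ∪ P.right x.2).card = k := by
      rw [Finset.card_union_of_disjoint (P.disjoint_left_right _ _), P.card_left, P.card_right,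
        hk]
    rw [eq_div_iff hchoose.ne']
    have := card_perm_map_eq (P.left x.1 ∪ P.right x.2) e (by rw [he, hc])
    rw [hc] at this
    exact_mod_cast this
  calc ((Finset.univ.filter fun σ => ∃ x, P.edge σ x = e).card : ℝ)
      ≤ ∑ x : Fin N × Fin N, ((Finset.univ.filter fun σ => P.edge σ x = e).card : ℝ) := by
        exact_mod_cast (Finset.card_le_card hsub).trans Finset.card_biUnion_le
    _ = _ := by
        rw [Finset.sum_congr rfl fun x _ => h1 x, Finset.sum_const, Finset.card_univ,
          Fintype.card_prod, Fintype.card_fin, nsmul_eq_mul]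
        push_cast
        ring

end BlockSystem

namespace UniformHypergraph

open Classical in
/-- Most permutations are balanced on both sides. -/
theorem exists_balanced_permutations {n N a b k : ℕ} (P : BlockSystem n N a b)
    (H : UniformHypergraph (Fin n) k) (hn : 0 < n) (hk : a + b = k) (hkn : k ≤ n) {ε θ : ℝ}
    (hε : 0 ≤ ε) (hε1 : ε ≤ 1) (hθ0 : 0 ≤ θ) (hθ1 : θ ≤ 1) (hkε : (k : ℝ) ^ 2 / n ≤ ε / 2)
    (hmin₁ : H.MinDegreeCond ε a) (hmin₂ : H.MinDegreeCond ε b)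
    (hco₁ : H.CodegreeCond ε a) (hco₂ : H.CodegreeCond ε b)
    (htail : 4 * n ^ (2 * k) * Real.exp (-((ε * H.density ^ 2 * N / 2) ^ 2 / (32 * n))) ≤
      θ / 2) :
    ∃ Q : Finset (Equiv.Perm (Fin n)), (n.factorial : ℝ) ≤ (1 + θ) * Q.card ∧
      ∀ σ ∈ Q, H.IsBalancedFor ε a P.right σ ∧ H.IsBalancedFor ε b P.left σ := by
  have h1 := H.card_not_isBalancedFor_le hn hk hkn hε hε1 hkε hmin₁ hco₁ P.right P.card_right
    P.disjoint_right
  have h2 := H.card_not_isBalancedFor_le hn ((add_comm b a).trans hk) hkn hε hε1 hkε hmin₂ hco₂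
    P.left P.card_left P.disjoint_left
  refine ⟨Finset.univ.filter fun σ => H.IsBalancedFor ε a P.right σ ∧
    H.IsBalancedFor ε b P.left σ, ?_, fun σ hσ => (Finset.mem_filter.1 hσ).2⟩
  set B₁ := Finset.univ.filter fun σ => ¬ H.IsBalancedFor ε a P.right σ with hB₁
  set B₂ := Finset.univ.filter fun σ => ¬ H.IsBalancedFor ε b P.left σ with hB₂
  set Q := Finset.univ.filter fun σ => H.IsBalancedFor ε a P.right σ ∧
    H.IsBalancedFor ε b P.left σ with hQ
  have h3 : (n.factorial : ℝ) ≤ Q.card + (B₁.card + B₂.card) := by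
    have : (Finset.univ : Finset (Equiv.Perm (Fin n))) ⊆ Q ∪ (B₁ ∪ B₂) := by
      intro σ _
      simp only [hQ, hB₁, hB₂, Finset.mem_union, Finset.mem_filter, Finset.mem_univ, true_and]
      tauto
    have h4 := (Finset.card_le_card this).trans ((Finset.card_union_le _ _).trans
      (Nat.add_le_add_left (Finset.card_union_le _ _) _))
    rw [Finset.card_univ, Fintype.card_perm, Fintype.card_fin] at h4
    exact_mod_cast h4
  have h4 := mul_le_mul_of_nonneg_left htail (Nat.cast_nonneg (α := ℝ) n.factorial)
  have h5 : (0 : ℝ) ≤ n.factorial := Nat.cast_nonneg _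
  have h6 : (n.factorial : ℝ) * (1 - θ / 2) ≤ Q.card := by linarith
  have h7 := mul_le_mul_of_nonneg_left h6 (by linarith : 0 ≤ 1 + θ)
  -- The inequality used is `(1 + θ) * (1 - θ / 2) ≥ 1`.
  have h8 : 0 ≤ (n.factorial : ℝ) * (θ * (1 - θ)) :=
    mul_nonneg h5 (mul_nonneg hθ0 (by linarith))
  linarith

-- The probabilistic core, with all numerical requirements as hypotheses. Under a balanced
-- permutation a given edge appears with probability at most `q = N ^ 2 / n.choose k * (1 + θ)`, the
-- factor `1 + θ` accounting for the restriction to balanced permutations. The number `K` is both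
-- the bound on the multiplicity of an edge and the number of colours.
open Classical in
theorem exists_packing_of_isPseudoRandom {n N k : ℕ} (hk : 2 ≤ k) (hN : 0 < N) (hnN : n = N * k)
    (H : UniformHypergraph (Fin n) k) {θ : ℝ} (hθ0 : 0 < θ) (hθ1 : θ ≤ 1 / 192)
    (hR : H.IsPseudoRandom (8 * θ ^ 3)) (hp : 0 < H.density)
    (hkθ : (k : ℝ) ^ 2 / n ≤ 4 * θ ^ 3) (hpN : 8 ≤ θ ^ 3 * H.density ^ 3 * N)
    (htail : 4 * n ^ (2 * k) * Real.exp (-((4 * θ ^ 3 * H.density ^ 2 * N) ^ 2 / (32 * n))) ≤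
      θ / 2) (r K : ℕ) (hK0 : 0 < K)
    (hK : r * (N ^ 2 / n.choose k * (1 + θ)) * (1 + 2 * θ) ≤ K)
    (hr : n.choose k * Real.exp (-(r * (N ^ 2 / n.choose k * (1 + θ)) * θ ^ 2)) < 1)
    (hy₁ : 2 * N * Real.exp (-(θ ^ 2 * (1 - θ) * H.density / (4 * K) * N / 4)) ≤ 1)
    (hy₂ : r * (8 * N * Real.exp (-(θ ^ 2 * (1 - θ) * H.density / (4 * K) * N / 4))) < 1) :
    ∃ C : Finset (Finset (Finset (Fin n))), H.IsPerfectMatchingPacking C ∧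
      C.card = r * ⌊(1 - θ) ^ 2 * H.density * N / K⌋₊ := by
  set p := H.density with hpdef
  have hab : k / 2 + (k - k / 2) = k := by omega
  obtain ⟨P⟩ := BlockSystem.nonempty_of_eq (n := n) (N := N) (a := k / 2) (b := k - k / 2)
    (by rw [hab]; exact hnN)
  have ha : 0 < k / 2 := by omega
  have hb : 0 < k - k / 2 := by omega
  have hkn : k ≤ n := by rw [hnN]; exact Nat.le_mul_of_pos_left k hN
  have hθ2 : 0 < θ ^ 2 := by positivity
  have hθ3 : θ ^ 3 ≤ θ ^ 2 * (1 / 192) := by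
    rw [pow_succ θ 2]; exact mul_le_mul_of_nonneg_left hθ1 hθ2.le
  have hθ4 : θ ^ 2 ≤ θ * (1 / 192) := by
    rw [sq]; exact mul_le_mul_of_nonneg_left hθ1 hθ0.le
  have hK' : (0 : ℝ) < K := by exact_mod_cast hK0
  obtain ⟨Q, hQcard, hQ⟩ := exists_balanced_permutations P H (by omega) hab hkn
    (ε := 8 * θ ^ 3) (θ := θ) (by positivity) (by linarith) hθ0.le (by linarith) (by linarith)
    hR.Ra hR.Rb hR.Re hR.Rf (by convert htail using 6; ring)
  have hQne : Q.Nonempty := by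
    rw [← Finset.card_pos]
    by_contra h0
    rw [Nat.eq_zero_of_not_pos h0, Nat.cast_zero, mul_zero] at hQcard
    exact absurd hQcard (not_le.2 (by exact_mod_cast n.factorial_pos))
  obtain ⟨f, hfQ, hf⟩ := exists_balanced_sample Q hQne H.edges (fun σ e => ∃ x, P.edge σ x = e)
    (q := N ^ 2 / n.choose k * (1 + θ)) hθ0.le (by linarith) r K
    (fun e he => by
      calc ((Q.filter fun σ => ∃ x, P.edge σ x = e).card : ℝ)
          ≤ ((Finset.univ.filter fun σ => ∃ x, P.edge σ x = e).card : ℝ) := by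
            exact_mod_cast Finset.card_le_card
              (Finset.filter_subset_filter _ (Finset.subset_univ Q))
        _ ≤ N ^ 2 / n.choose k * n.factorial := by
            convert P.card_mem_image_edge_le hab hkn e (H.sized he)
        _ ≤ N ^ 2 / n.choose k * ((1 + θ) * Q.card) := by gcongr
        _ = _ := by ring)
    hK (lt_of_le_of_lt (mul_le_mul_of_nonneg_right
      (by exact_mod_cast (by simpa [UniformHypergraph.numEdges] using H.numEdges_le_choose)) (Real.exp_nonneg _)) hr)
  -- At most `K` samples contain `e`, so they can receive distinct colours. Sample `i` later keeps
  -- `e` exactly when the random colour `l e` equals `g e i`; hence no two samples keep the same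
  -- edge.
  have hg : ∀ e : Finset (Fin n), ∃ g : Fin r → Fin K, e ∈ H.edges →
      Set.InjOn g {i | ∃ x, P.edge (f i) x = e} := by
    intro e
    by_cases he : e ∈ H.edges
    · have hle := hf e he
      set I := Finset.univ.filter fun i => ∃ x, P.edge (f i) x = e with hI
      refine ⟨fun i => if h : i ∈ I then Fin.castLE hle (I.equivFin ⟨i, h⟩) else ⟨0, hK0⟩,
        fun _ i hi j hj hij => ?_⟩
      have hi' : i ∈ I := by simpa [hI] using hi
      have hj' : j ∈ I := by simpa [hI] using hj
      simp only [hi', hj', dif_pos] at hij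
      simpa using I.equivFin.injective (Fin.castLE_injective hle hij)
    · exact ⟨fun _ => ⟨0, hK0⟩, fun h => absurd h he⟩
  choose g hg using hg
  set 𝒯 : Finset (Fin r × (Finset (Fin N) × Finset (Fin N))) :=
    Finset.univ ×ˢ Finset.univ.filter fun x => N < x.1.card + x.2.card with h𝒯
  set A : Fin r × (Finset (Fin N) × Finset (Fin N)) → Finset (Finset (Fin n)) := fun t =>
    (edgesBetween (P.graph H (f t.1)) t.2.1 t.2.2).image (P.edge (f t.1)) with hA
  have hAcard : ∀ t, (A t).card = (edgesBetween (P.graph H (f t.1)) t.2.1 t.2.2).card :=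
    fun t => Finset.card_image_of_injective _ (P.edge_injective ha hb _)
  -- With `ε = 8 * θ ^ 3` and `δ = θ`, the condition `24 * ε ≤ δ ^ 2` is precisely `θ ≤ 1 / 192`.
  have hcut : ∀ t ∈ 𝒯, (1 - θ) * (p * t.2.1.card * t.2.2.card) ≤ (A t).card := by
    intro t ht
    rw [h𝒯, Finset.mem_product, Finset.mem_filter] at ht
    rw [hAcard]
    obtain ⟨hb1, hb2⟩ := hQ _ (hfQ t.1)
    exact P.card_edgesBetween_graph_ge H hab hp (by positivity) (by linarith) (by linarith)
      (by linarith) hpN _ hb1 hb2 _ _ ht.2.2.le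
  obtain ⟨l, hl⟩ := exists_labelling hK0 𝒯 A (fun t e => g e t.1) hθ0.le (by linarith) (by
    refine lt_of_le_of_lt ?_ hy₂
    calc ∑ t ∈ 𝒯, Real.exp (-(θ ^ 2 * (A t).card / (4 * K)))
        ≤ ∑ t ∈ 𝒯, Real.exp (-(θ ^ 2 * (1 - θ) * p / (4 * K) * t.2.1.card * t.2.2.card)) := by
          refine Finset.sum_le_sum fun t ht => Real.exp_le_exp.2 (neg_le_neg ?_)
          calc θ ^ 2 * (1 - θ) * p / (4 * K) * t.2.1.card * t.2.2.card
              = θ ^ 2 * ((1 - θ) * (p * t.2.1.card * t.2.2.card)) / (4 * K) := by ring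
            _ ≤ _ := by
              gcongr
              exact hcut t ht
      _ = ∑ _i : Fin r, ∑ x ∈ Finset.univ.filter
            (fun x : Finset (Fin N) × Finset (Fin N) => N < x.1.card + x.2.card),
            Real.exp (-(θ ^ 2 * (1 - θ) * p / (4 * K) * x.1.card * x.2.card)) := by
          rw [h𝒯, Finset.sum_product]
      _ ≤ ∑ _i : Fin r, _ := Finset.sum_le_sum fun _ _ =>
          sum_exp_neg_card_mul_card_le N (by
            have : 0 ≤ 1 - θ := by linarith
            positivity) hy₁
      _ = _ := by rw [Finset.sum_const, Finset.card_univ, Fintype.card_fin, nsmul_eq_mul])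
  -- One factor `1 - θ` is lost in the edge count and one in the colouring.
  set s := ⌊(1 - θ) ^ 2 * p * N / K⌋₊ with hs
  refine P.exists_packing H ha hb hN f
    (fun i => (P.graph H (f i)).filter fun x => l (P.edge (f i) x) = g (P.edge (f i) x) i)
    ?_ ?_ ?_
  · intro i x hx
    exact (Finset.mem_filter.1 (Finset.mem_filter.1 hx).1).2
  · intro i j hij x hx y hy hxy
    rw [Finset.mem_filter] at hx hy
    have he : P.edge (f i) x ∈ H.edges := (Finset.mem_filter.1 hx.1).2
    refine hij (hg _ he ⟨x, rfl⟩ ⟨y, hxy.symm⟩ ?_)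
    rw [← hx.2, hxy, hy.2]
  · intro i S T
    rcases le_or_gt (S.card + T.card) N with hST | hST
    · exact (Nat.mul_le_mul_left s hST).trans (Nat.le_add_right _ _)
    have ht : (i, (S, T)) ∈ 𝒯 := by
      rw [h𝒯, Finset.mem_product, Finset.mem_filter]
      exact ⟨Finset.mem_univ _, Finset.mem_univ _, hST⟩
    have h1 := hl _ ht
    have h2 := hcut _ ht
    have h3 : ((A (i, (S, T))).filter fun e => l e = g e i).card =
        (edgesBetween ((P.graph H (f i)).filter
          fun x => l (P.edge (f i) x) = g (P.edge (f i) x) i) S T).card := by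
      rw [← Finset.card_image_of_injective (edgesBetween _ S T) (P.edge_injective ha hb (f i))]
      congr 1
      ext e
      simp only [hA, edgesBetween, Finset.mem_filter, Finset.mem_image]
      constructor
      · rintro ⟨⟨x, hx, rfl⟩, he⟩
        exact ⟨x, ⟨⟨hx.1, he⟩, hx.2⟩, rfl⟩
      · rintro ⟨x, ⟨⟨hx, he⟩, hx2⟩, rfl⟩
        exact ⟨⟨x, ⟨hx, hx2⟩, rfl⟩, he⟩
    rw [h3] at h1
    dsimp only at h1 h2
    have hSN : (S.card : ℝ) ≤ N := by
      simpa using (Nat.cast_le (α := ℝ)).2 (Finset.card_le_univ S)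
    have hTN : (T.card : ℝ) ≤ N := by
      simpa using (Nat.cast_le (α := ℝ)).2 (Finset.card_le_univ T)
    have hST' : (N : ℝ) ≤ S.card + T.card := by exact_mod_cast hST.le
    have hsle : (s : ℝ) ≤ (1 - θ) ^ 2 * p * N / K := Nat.floor_le (by positivity)
    -- The product bound becomes the cut condition through `(N - |S|) * (N - |T|) ≥ 0`, that is, `N
    -- * (|S| + |T| - N) ≤ |S| * |T|`.
    have h4 : (s : ℝ) * (S.card + T.card - N) ≤ (1 - θ) * (A (i, (S, T))).card / K := by
      calc (s : ℝ) * (S.card + T.card - N)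
          ≤ (1 - θ) ^ 2 * p * N / K * (S.card + T.card - N) :=
            mul_le_mul_of_nonneg_right hsle (by linarith)
        _ = (1 - θ) ^ 2 * p / K * (N * (S.card + T.card - N)) := by ring
        _ ≤ (1 - θ) ^ 2 * p / K * (S.card * T.card) := by
            refine mul_le_mul_of_nonneg_left ?_ (by positivity)
            nlinarith [mul_nonneg (sub_nonneg.2 hSN) (sub_nonneg.2 hTN)]
        _ = (1 - θ) * ((1 - θ) * (p * S.card * T.card)) / K := by ring
        _ ≤ _ := by
            have : 0 ≤ 1 - θ := by linarith
            gcongr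
    have h5 : (s : ℝ) * (S.card + T.card) ≤ s * N + (edgesBetween ((P.graph H (f i)).filter
        fun x => l (P.edge (f i) x) = g (P.edge (f i) x) i) S T).card := by
      linarith
    exact_mod_cast h5

end UniformHypergraph

/-! ### Choice of the numerical parameters. -/

theorem BlockSystem.sq_le_choose {n N a b k : ℕ} (P : BlockSystem n N a b) (ha : 0 < a)
    (hb : 0 < b) (hk : a + b = k) : N ^ 2 ≤ n.choose k := by
  have h1 : (Finset.univ.image (P.edge 1)).card = N ^ 2 := by
    rw [Finset.card_image_of_injective _ (P.edge_injective ha hb 1), Finset.card_univ,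
      Fintype.card_prod, Fintype.card_fin, sq]
  have h2 : (Finset.powersetCard k (Finset.univ : Finset (Fin n))).card = n.choose k := by
    rw [Finset.card_powersetCard, Finset.card_univ, Fintype.card_fin]
  rw [← h1, ← h2]
  refine Finset.card_le_card fun e he => ?_
  obtain ⟨x, -, rfl⟩ := Finset.mem_image.1 he
  exact Finset.mem_powersetCard.2 ⟨Finset.subset_univ _, hk ▸ P.card_edge 1 x⟩

/-- As `θ, p ≤ 1`, the single quantity `θ ^ 6 * p ^ 4 * n` bounds from below every product of
smaller powers of `θ` and `p` with `n`. The tail exponent equals this quantity divided by `2 * k ^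
2`, which is why these powers occur. -/
theorem concentration_parameters {n N k : ℕ} (hk : 2 ≤ k) (hN : 0 < N) (hnN : n = N * k)
    {θ p : ℝ} (hθ0 : 0 < θ) (hθ1 : θ ≤ 1 / 192) (hp : 0 < p) (hp1 : p ≤ 1)
    (hL : (k : ℝ) + 6 ≤ Real.log n)
    (hZ : 1000 * (k : ℝ) ^ 3 * Real.log n ^ 2 ≤ θ ^ 6 * p ^ 4 * n) :
    (k : ℝ) ^ 2 / n ≤ 4 * θ ^ 3 ∧ 8 ≤ θ ^ 3 * p ^ 3 * N ∧
    4 * n ^ (2 * k) * Real.exp (-((4 * θ ^ 3 * p ^ 2 * N) ^ 2 / (32 * n))) ≤ θ / 2 := by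
  obtain ⟨L, hLdef⟩ : ∃ L, L = Real.log n := ⟨_, rfl⟩
  obtain ⟨Z, hZdef⟩ : ∃ Z, Z = θ ^ 6 * p ^ 4 * n := ⟨_, rfl⟩
  rw [← hLdef] at hL hZ
  rw [← hZdef] at hZ
  have hk' : (2 : ℝ) ≤ k := by exact_mod_cast hk
  have hkn : k ≤ n := by rw [hnN]; exact Nat.le_mul_of_pos_left k hN
  have hn0 : 0 < n := by omega
  have hn : (0 : ℝ) < n := by exact_mod_cast hn0
  have hnN' : (n : ℝ) = N * k := by exact_mod_cast hnN
  have hL8 : 8 ≤ L := by linarith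
  have hexpL : Real.exp L = n := by rw [hLdef]; exact Real.exp_log hn
  have hpow : ∀ m : ℕ, (n : ℝ) ^ m = Real.exp (m * L) := fun m => by
    rw [Real.exp_nat_mul, hexpL]
  have hLn : L ≤ n := by linarith [Real.add_one_le_exp L]
  have hZij : ∀ i j : ℕ, i ≤ 6 → j ≤ 4 → Z ≤ θ ^ i * p ^ j * n := by
    intro i j hi hj
    have h1 : θ ^ 6 ≤ θ ^ i := pow_le_pow_of_le_one hθ0.le (by linarith) hi
    have h2 : p ^ 4 ≤ p ^ j := pow_le_pow_of_le_one hp.le hp1 hj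
    rw [hZdef]
    gcongr
  have hk3 : (8 : ℝ) ≤ (k : ℝ) ^ 3 := by
    calc (8 : ℝ) = 2 ^ 3 := by norm_num
      _ ≤ (k : ℝ) ^ 3 := by gcongr
  have hk2 : (k : ℝ) ^ 2 ≤ (k : ℝ) ^ 3 := pow_le_pow_right₀ (by linarith) (by norm_num)
  have hL2 : L ≤ L ^ 2 := le_self_pow₀ (by linarith) two_ne_zero
  have hZL : 1000 * (k : ℝ) ^ 3 * L ≤ Z := by
    refine le_trans ?_ hZ
    gcongr
  have hZk : 1000 * (k : ℝ) ^ 3 ≤ Z := by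
    refine le_trans ?_ hZL
    exact le_mul_of_one_le_right (by positivity) (by linarith)
  have hθn : 1 ≤ θ * n := by
    have := hZij 1 0 (by norm_num) (by norm_num)
    simp only [pow_one, pow_zero, mul_one] at this
    linarith
  have h8n : (8 : ℝ) ≤ n := hL8.trans hLn
  refine ⟨?_, ?_, ?_⟩
  · rw [div_le_iff₀ hn]
    have := hZij 3 0 (by norm_num) (by norm_num)
    rw [pow_zero, mul_one] at this
    linarith
  · have h1 := hZij 3 3 (by norm_num) (by norm_num)
    rw [hnN'] at h1
    have h2 : 8 * (k : ℝ) ≤ θ ^ 3 * p ^ 3 * N * k := by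
      have : (k : ℝ) ≤ (k : ℝ) ^ 2 := by nlinarith
      linarith
    exact le_of_mul_le_mul_right h2 (by linarith)
  · have h1 : (4 * θ ^ 3 * p ^ 2 * N) ^ 2 / (32 * n) = Z / (2 * k ^ 2) := by
      rw [hZdef, hnN']
      field_simp
      ring
    -- The exponential beats `n ^ (2 * k + 2)`: the union bound uses `n ^ (2 * k)`, and the rest
    -- brings the tail below `1 / (2 * n) ≤ θ / 2`.
    have h2 : ((2 * k + 2 : ℕ) : ℝ) * L ≤ Z / (2 * k ^ 2) := by
      rw [le_div_iff₀ (by positivity)]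
      push_cast
      have : (2 * (k : ℝ) + 2) * (2 * k ^ 2) ≤ 6 * (k : ℝ) ^ 3 := by
        have : (k : ℝ) ^ 2 * 2 ≤ (k : ℝ) ^ 2 * k := by gcongr
        linarith
      nlinarith
    have h3 : Real.exp (-(Z / (2 * k ^ 2))) * n ^ (2 * k + 2) ≤ 1 := by
      rw [hpow, ← Real.exp_add]
      exact Real.exp_le_one_iff.2 (by linarith)
    rw [h1]
    have h4 : 4 * n ^ (2 * k) * Real.exp (-(Z / (2 * k ^ 2))) * (2 * n) ≤ 1 := by
      refine le_trans ?_ h3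
      have h5 : 0 ≤ Real.exp (-(Z / (2 * k ^ 2))) * n ^ (2 * k) * n := by positivity
      have h6 := mul_le_mul_of_nonneg_left h8n h5
      calc 4 * n ^ (2 * k) * Real.exp (-(Z / (2 * k ^ 2))) * (2 * n)
          = Real.exp (-(Z / (2 * k ^ 2))) * n ^ (2 * k) * n * 8 := by ring
        _ ≤ _ := h6
        _ = _ := by ring
    refine le_of_mul_le_mul_right (h4.trans ?_) (by positivity : (0 : ℝ) < 2 * n)
    linarith

/-- Take the least `r` for which `r * q * θ ^ 2` reaches `X`, and the least admissible `K`. Since `r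
* q * θ ≥ X ≥ 8`, rounding `K` up is absorbed by passing from `2 * θ` to `3 * θ`. -/
theorem exists_sample_size {X q θ : ℝ} (hX : 8 ≤ X) (hq0 : 0 < q) (hq2 : q ≤ 2) (hθ0 : 0 < θ)
    (hθ1 : θ ≤ 1 / 192) :
    ∃ r K : ℕ, 0 < K ∧ r * q * (1 + 2 * θ) ≤ K ∧ X ≤ r * q * θ ^ 2 ∧ K * θ ^ 2 ≤ 3 * X ∧
      K ≤ r * q * (1 + 3 * θ) ∧ r < X / (q * θ ^ 2) + 1 := by
  have hqθ : 0 < q * θ ^ 2 := by positivity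
  obtain ⟨r, hr⟩ : ∃ r, r = ⌈X / (q * θ ^ 2)⌉₊ := ⟨_, rfl⟩
  have hr1 : X ≤ r * q * θ ^ 2 := by
    have := Nat.le_ceil (X / (q * θ ^ 2))
    rw [div_le_iff₀ hqθ, ← hr] at this
    rw [mul_assoc]; exact this
  have hr2 : (r : ℝ) < X / (q * θ ^ 2) + 1 := hr ▸ Nat.ceil_lt_add_one (by positivity)
  obtain ⟨K, hKdef⟩ : ∃ K, K = ⌈r * q * (1 + 2 * θ)⌉₊ := ⟨_, rfl⟩
  have hθ21 : θ ^ 2 ≤ 1 := pow_le_one₀ hθ0.le (by linarith)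
  have hrq0 : 0 < (r : ℝ) * q := by
    by_contra h
    have := mul_nonpos_of_nonpos_of_nonneg (not_lt.1 h) (sq_nonneg θ)
    linarith
  have hK1 : r * q * (1 + 2 * θ) ≤ K := hKdef ▸ Nat.le_ceil _
  have hK2 : (K : ℝ) < r * q * (1 + 2 * θ) + 1 := hKdef ▸ Nat.ceil_lt_add_one (by positivity)
  have hK0 : 0 < K := hKdef ▸ Nat.ceil_pos.2 (by positivity)
  refine ⟨r, K, hK0, hK1, hr1, ?_, ?_, hr2⟩
  · have h1 : r * q * θ ^ 2 ≤ X + 2 := by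
      have h2 := mul_le_mul_of_nonneg_right hr2.le hqθ.le
      rw [add_mul, div_mul_cancel₀ _ hqθ.ne', one_mul] at h2
      have h3 : q * θ ^ 2 ≤ 2 * 1 := mul_le_mul hq2 hθ21 (sq_nonneg _) (by norm_num)
      linarith
    have h4 := mul_le_mul_of_nonneg_right hK2.le (sq_nonneg θ)
    have h5 : r * q * θ ^ 2 * (1 + 2 * θ) ≤ (X + 2) * (1 + 2 * (1 / 192)) := by gcongr
    linarith
  · have h1 : r * q * θ ^ 2 ≤ r * q * θ := by
      refine mul_le_mul_of_nonneg_left ?_ hrq0.le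
      rw [sq]
      exact mul_le_of_le_one_left hθ0.le (by linarith)
    linarith

/-- As `p * N / K ≥ 1 / θ`, the floor costs only another factor of about `1 - θ`, and `(1 - θ) ^ 2 -
θ ≥ 1 - 3 * θ`. The total loss is then controlled by `(1 - 8 * θ) * (1 + 3 * θ) * (1 + θ) ≤ 1 - 3 *
θ`. -/
theorem le_sample_size_mul_floor {r K : ℕ} {θ p c q N : ℝ} (hθ0 : 0 < θ) (hθ1 : θ ≤ 1 / 192)
    (hp : 0 < p) (hN : 0 < N) (hc : 0 < c) (hq : q = N ^ 2 / c * (1 + θ)) (hK : 0 < K)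
    (hKN : K ≤ θ * p * N) (hrK : K ≤ r * q * (1 + 3 * θ)) :
    (1 - 8 * θ) * (p * c) / N ≤ r * ⌊(1 - θ) ^ 2 * p * N / K⌋₊ := by
  have hK' : (0 : ℝ) < K := by exact_mod_cast hK
  have hfl := (Nat.lt_floor_add_one ((1 - θ) ^ 2 * p * N / K)).le
  have hone : 1 ≤ θ * (p * N / K) := by
    rw [mul_div_assoc', le_div_iff₀ hK', one_mul]
    linarith
  have hfl2 : (1 - 3 * θ) * (p * N / K) ≤ ⌊(1 - θ) ^ 2 * p * N / K⌋₊ := by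
    have e : (1 - θ) ^ 2 * p * N / K = (1 - θ) ^ 2 * (p * N / K) := by ring
    have h0 : 0 ≤ θ ^ 2 * (p * N / K) := by positivity
    rw [e] at hfl ⊢
    linarith
  have hqm : p * c / N * q = p * N * (1 + θ) := by
    rw [hq]
    field_simp
  have hmain : (1 - 8 * θ) * (p * c) / N * K ≤ (1 - 3 * θ) * (p * N / K) * r * K := by
    have hm0 : 0 ≤ (p * c) / N := by positivity
    calc (1 - 8 * θ) * (p * c) / N * K = (1 - 8 * θ) * ((p * c) / N) * K := by
          ring
      _ ≤ (1 - 8 * θ) * ((p * c) / N) * (r * q * (1 + 3 * θ)) := by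
          refine mul_le_mul_of_nonneg_left hrK (mul_nonneg (by linarith) hm0)
      _ = (1 - 8 * θ) * r * (1 + 3 * θ) * ((p * c) / N * q) := by ring
      _ = ((1 - 8 * θ) * (1 + 3 * θ) * (1 + θ)) * (p * N * r) := by rw [hqm]; ring
      _ ≤ (1 - 3 * θ) * (p * N * r) := by
          refine mul_le_mul_of_nonneg_right ?_ (by positivity)
          have h2 : 0 ≤ θ ^ 2 := sq_nonneg θ
          have h3 : 0 ≤ θ ^ 3 := by positivity
          linarith
      _ = _ := by field_simp
  refine (le_of_mul_le_mul_right hmain hK').trans ?_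
  calc (1 - 3 * θ) * (p * N / K) * r ≤ ⌊(1 - θ) ^ 2 * p * N / K⌋₊ * r := by gcongr
    _ = _ := by ring

theorem exists_sampling_parameters {n N k : ℕ} (hk : 2 ≤ k) (hN : 0 < N) (hnN : n = N * k)
    {θ p : ℝ} (hθ0 : 0 < θ) (hθ1 : θ ≤ 1 / 192) (hp : 0 < p) (hp1 : p ≤ 1)
    (hL : (k : ℝ) + 6 ≤ Real.log n)
    (hZ : 1000 * (k : ℝ) ^ 3 * Real.log n ^ 2 ≤ θ ^ 6 * p ^ 4 * n)
    (hNchoose : N ^ 2 ≤ n.choose k) :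
    ∃ r K : ℕ, 0 < K ∧ r * (N ^ 2 / n.choose k * (1 + θ)) * (1 + 2 * θ) ≤ K ∧
      n.choose k * Real.exp (-(r * (N ^ 2 / n.choose k * (1 + θ)) * θ ^ 2)) < 1 ∧
      2 * N * Real.exp (-(θ ^ 2 * (1 - θ) * p / (4 * K) * N / 4)) ≤ 1 ∧
      r * (8 * N * Real.exp (-(θ ^ 2 * (1 - θ) * p / (4 * K) * N / 4))) < 1 ∧
      (1 - 8 * θ) * (p * n.choose k) / N ≤ r * ⌊(1 - θ) ^ 2 * p * N / K⌋₊ := by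
  obtain ⟨L, hLdef⟩ : ∃ L, L = Real.log n := ⟨_, rfl⟩
  obtain ⟨Z, hZdef⟩ : ∃ Z, Z = θ ^ 6 * p ^ 4 * n := ⟨_, rfl⟩
  rw [← hLdef] at hL hZ
  rw [← hZdef] at hZ
  have hk' : (2 : ℝ) ≤ k := by exact_mod_cast hk
  have hkn : k ≤ n := by rw [hnN]; exact Nat.le_mul_of_pos_left k hN
  have hn0 : 0 < n := by omega
  have hn : (0 : ℝ) < n := by exact_mod_cast hn0
  have hN' : (0 : ℝ) < N := by exact_mod_cast hN
  have hnN' : (n : ℝ) = N * k := by exact_mod_cast hnN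
  have hL8 : 8 ≤ L := by linarith
  have hexpL : Real.exp L = n := by rw [hLdef]; exact Real.exp_log hn
  have hpow : ∀ m : ℕ, (n : ℝ) ^ m = Real.exp (m * L) := fun m => by
    rw [Real.exp_nat_mul, hexpL]
  have hLn : L ≤ n := by linarith [Real.add_one_le_exp L]
  have hZij : ∀ i j : ℕ, i ≤ 6 → j ≤ 4 → Z ≤ θ ^ i * p ^ j * n := by
    intro i j hi hj
    have h1 : θ ^ 6 ≤ θ ^ i := pow_le_pow_of_le_one hθ0.le (by linarith) hi
    have h2 : p ^ 4 ≤ p ^ j := pow_le_pow_of_le_one hp.le hp1 hj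
    rw [hZdef]
    gcongr
  have hk3 : (8 : ℝ) ≤ (k : ℝ) ^ 3 := by
    calc (8 : ℝ) = 2 ^ 3 := by norm_num
      _ ≤ (k : ℝ) ^ 3 := by gcongr
  have hk2 : (k : ℝ) ^ 2 ≤ (k : ℝ) ^ 3 := pow_le_pow_right₀ (by linarith) (by norm_num)
  have hL2 : L ≤ L ^ 2 := le_self_pow₀ (by linarith) two_ne_zero
  have hZL : 1000 * (k : ℝ) ^ 3 * L ≤ Z := by
    refine le_trans ?_ hZ
    gcongr
  have hZk : 1000 * (k : ℝ) ^ 3 ≤ Z := by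
    refine le_trans ?_ hZL
    exact le_mul_of_one_le_right (by positivity) (by linarith)
  have hθn : 1 ≤ θ * n := by
    have := hZij 1 0 (by norm_num) (by norm_num)
    simp only [pow_one, pow_zero, mul_one] at this
    linarith
  have hNchoose' : (N : ℝ) ^ 2 ≤ n.choose k := by exact_mod_cast hNchoose
  have hchoose0 : (0 : ℝ) < n.choose k := by exact_mod_cast Nat.choose_pos hkn
  have hchoosen : (n.choose k : ℝ) ≤ n ^ k := by exact_mod_cast Nat.choose_le_pow n k
  obtain ⟨q, hq⟩ : ∃ q : ℝ, q = N ^ 2 / n.choose k * (1 + θ) := ⟨_, rfl⟩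
  have hq0 : 0 < q := by rw [hq]; positivity
  have hq2 : q ≤ 2 := by
    have h1 : (N : ℝ) ^ 2 / n.choose k ≤ 1 := (div_le_one hchoose0).2 hNchoose'
    calc q ≤ 1 * (1 + 1) := by
          rw [hq]
          gcongr
          linarith
      _ = 2 := by norm_num
  have hqinv : 1 ≤ q * n ^ k := by
    have h1 : 1 ≤ (N : ℝ) ^ 2 / n.choose k * n ^ k := by
      rw [div_mul_eq_mul_div, le_div_iff₀ hchoose0, one_mul]
      have h2 : (1 : ℝ) ≤ N ^ 2 := one_le_pow₀ (by exact_mod_cast hN)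
      exact hchoosen.trans (le_mul_of_one_le_left (by positivity) h2)
    calc (1 : ℝ) ≤ N ^ 2 / n.choose k * n ^ k := h1
      _ ≤ N ^ 2 / n.choose k * n ^ k * (1 + θ) :=
          le_mul_of_one_le_right (by positivity) (by linarith)
      _ = q * n ^ k := by rw [hq]; ring
  -- The value `(k + 1) * L` makes the failure probability of one edge at most `n ^ (-(k + 1))`,
  -- enough for a union bound over at most `n ^ k` edges.
  obtain ⟨r, K, hK0, hK1, hr1, hKup, hrK, hr2⟩ := exists_sample_size
    (X := ((k : ℝ) + 1) * L) (by
      have : L ≤ ((k : ℝ) + 1) * L := le_mul_of_one_le_left (by linarith) (by linarith)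
      linarith) hq0 hq2 hθ0 hθ1
  have hqθ : 0 < q * θ ^ 2 := by positivity
  have hθpN : (K : ℝ) ≤ θ * p * N := by
    have h1 := hZij 3 1 (by norm_num) (by norm_num)
    rw [pow_one, hnN'] at h1
    have h2 : K * θ ^ 2 * k ≤ θ ^ 3 * p * N * k := by
      calc K * θ ^ 2 * k ≤ 3 * (((k : ℝ) + 1) * L) * k := by gcongr
        _ ≤ 1000 * (k : ℝ) ^ 3 * L := by
            have h3 : ((k : ℝ) + 1) * k ≤ 2 * k * k := by gcongr; linarith
            have h4 : ((k : ℝ) + 1) * k * L ≤ 2 * (k : ℝ) ^ 3 * L :=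
              mul_le_mul_of_nonneg_right (by linarith) (by linarith)
            have h5 : 0 ≤ (k : ℝ) ^ 3 * L := by positivity
            linarith
        _ ≤ _ := by linarith
    have h3 : K * θ ^ 2 ≤ θ * p * N * θ ^ 2 := by
      have := le_of_mul_le_mul_right h2 (by linarith)
      linarith
    exact le_of_mul_le_mul_right h3 (by positivity)
  obtain ⟨E, hE⟩ : ∃ E, E = θ ^ 2 * (1 - θ) * p / (4 * K) * N / 4 := ⟨_, rfl⟩
  -- Since `K` is of order `k * L / θ ^ 2`, this is where a bound of order `k ^ 3 * L ^ 2` on `θ ^ 4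
  -- * p * n` is needed. The number `k + 7` serves `r ≤ n ^ (k + 4)`, `8 * N ≤ n ^ 2` and one spare
  -- factor `n`.
  have hElow : ((k : ℝ) + 7) * L ≤ E := by
    have h1 := hZij 4 1 (by norm_num) (by norm_num)
    rw [pow_one, hnN'] at h1
    have h2 : θ ^ 2 * p * N / (32 * K) ≤ E := by
      have : θ ^ 2 * (1 / 2) * p / (4 * K) * N / 4 ≤ E := by
        rw [hE]
        gcongr
        linarith
      refine le_trans (le_of_eq ?_) this
      field_simp
      norm_num
    refine le_trans ?_ h2
    rw [le_div_iff₀ (by positivity)]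
    have h3 : ((k : ℝ) + 7) * L * (32 * K) * (θ ^ 2 * k) ≤ θ ^ 2 * p * N * (θ ^ 2 * k) := by
      calc ((k : ℝ) + 7) * L * (32 * K) * (θ ^ 2 * k)
          = 32 * ((k : ℝ) + 7) * k * L * (K * θ ^ 2) := by ring
        _ ≤ 32 * ((k : ℝ) + 7) * k * L * (3 * (((k : ℝ) + 1) * L)) := by gcongr
        _ = 96 * (((k : ℝ) + 7) * k * ((k : ℝ) + 1)) * L ^ 2 := by ring
        _ ≤ 96 * (5 * k * k * (2 * k)) * L ^ 2 := by
            gcongr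
            · linarith
            · linarith
        _ = 960 * ((k : ℝ) ^ 3 * L ^ 2) := by ring
        _ ≤ 1000 * (k : ℝ) ^ 3 * L ^ 2 := by
            have : 0 ≤ (k : ℝ) ^ 3 * L ^ 2 := by positivity
            linarith
        _ ≤ _ := by linarith
    exact le_of_mul_le_mul_right h3 (by positivity)
  have hexpE : Real.exp (-E) * n ^ (k + 7) ≤ 1 := by
    rw [hpow, ← Real.exp_add]
    refine Real.exp_le_one_iff.2 ?_
    push_cast
    linarith
  have h8n : (8 : ℝ) ≤ n := hL8.trans hLn
  have hNn : (N : ℝ) ≤ n := by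
    rw [hnN']
    exact le_mul_of_one_le_right hN'.le (by linarith)
  have hrn : (r : ℝ) ≤ n ^ (k + 4) := by
    have h1 : 1 / (q * θ ^ 2) ≤ n ^ (k + 2) := by
      rw [div_le_iff₀ hqθ]
      calc (1 : ℝ) ≤ (q * n ^ k) * (θ * n) ^ 2 := by
            have : (1 : ℝ) ≤ (θ * n) ^ 2 := one_le_pow₀ hθn
            exact one_le_mul_of_one_le_of_one_le hqinv this
        _ = _ := by ring
    have h2 : ((k : ℝ) + 1) * L / (q * θ ^ 2) ≤ (n - 1) * n * n ^ (k + 2) := by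
      calc ((k : ℝ) + 1) * L / (q * θ ^ 2) = ((k : ℝ) + 1) * L * (1 / (q * θ ^ 2)) := by ring
        _ ≤ _ := by
            have h4 : (k : ℝ) + 1 ≤ n - 1 := by
              linarith
            have h5 : (0 : ℝ) ≤ n - 1 := by linarith
            gcongr
    have h3 : (1 : ℝ) ≤ n * n ^ (k + 2) := by
      rw [← pow_succ']
      exact one_le_pow₀ (by linarith)
    calc (r : ℝ) ≤ (n - 1) * n * n ^ (k + 2) + n * n ^ (k + 2) := by linarith
      _ = _ := by ring
  refine ⟨r, K, hK0, by rw [← hq]; exact hK1, ?_, ?_, ?_,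
    le_sample_size_mul_floor hθ0 hθ1 hp hN' hchoose0 hq hK0 hθpN hrK⟩
  · rw [← hq]
    calc n.choose k * Real.exp (-(r * q * θ ^ 2))
        ≤ n ^ k * Real.exp (-(((k : ℝ) + 1) * L)) := by
          gcongr
      _ = Real.exp (-L) := by
          rw [hpow, ← Real.exp_add]; congr 1; ring
      _ < 1 := Real.exp_lt_one_iff.2 (by linarith)
  · rw [← hE]
    calc 2 * N * Real.exp (-E) ≤ Real.exp (-E) * n ^ (k + 7) := by
          rw [mul_comm]
          gcongr
          calc (2 : ℝ) * N ≤ n * n := by gcongr; linarith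
            _ = n ^ 2 := by ring
            _ ≤ n ^ (k + 7) := pow_le_pow_right₀ (by linarith) (by omega)
      _ ≤ 1 := hexpE
  · rw [← hE]
    have h1 : r * (8 * N) ≤ (n : ℝ) ^ (k + 6) := by
      calc (r : ℝ) * (8 * N) ≤ n ^ (k + 4) * (n * n) := by gcongr
        _ = _ := by ring
    have h2 : Real.exp (-E) * n ^ (k + 6) * n ≤ 1 := by
      refine le_trans (le_of_eq ?_) hexpE
      ring
    have h3 : 0 < Real.exp (-E) * n ^ (k + 6) := by positivity
    calc r * (8 * N * Real.exp (-E)) = Real.exp (-E) * (r * (8 * N)) := by ring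
      _ ≤ Real.exp (-E) * n ^ (k + 6) := by gcongr
      _ < 1 := by linarith [mul_le_mul_of_nonneg_left h8n h3.le]

/-! ### The packing theorem, explicit and asymptotic. -/

namespace UniformHypergraph

/-- The packing theorem with explicit bounds on the parameters. -/
theorem exists_packing_card_ge {n N k : ℕ} (hk : 2 ≤ k) (hN : 0 < N) (hnN : n = N * k)
    (H : UniformHypergraph (Fin n) k) {θ : ℝ} (hθ0 : 0 < θ) (hθ1 : θ ≤ 1 / 192)
    (hR : H.IsPseudoRandom (8 * θ ^ 3)) (hp : 0 < H.density)
    (hL : (k : ℝ) + 6 ≤ Real.log n)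
    (hZ : 1000 * (k : ℝ) ^ 3 * Real.log n ^ 2 ≤ θ ^ 6 * H.density ^ 4 * n) :
    ∃ C : Finset (Finset (Finset (Fin n))), H.IsPerfectMatchingPacking C ∧
      (1 - 8 * θ) * H.numEdges / N ≤ C.card := by
  have hkn : k ≤ n := by rw [hnN]; exact Nat.le_mul_of_pos_left k hN
  have hchoose0 : (0 : ℝ) < n.choose k := by exact_mod_cast Nat.choose_pos hkn
  obtain ⟨P⟩ := BlockSystem.nonempty_of_eq (n := n) (N := N) (a := k / 2) (b := k - k / 2)
    (by rw [hnN]; congr 1; omega)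
  obtain ⟨h1, h2, h3⟩ := concentration_parameters hk hN hnN hθ0 hθ1 hp H.density_le_one hL hZ
  obtain ⟨r, K, hK0, hK, hr, hy₁, hy₂, hrK⟩ := exists_sampling_parameters hk hN hnN hθ0 hθ1 hp
    H.density_le_one hL hZ (P.sq_le_choose (by omega) (by omega) (by omega))
  obtain ⟨C, hC, hCcard⟩ := H.exists_packing_of_isPseudoRandom hk hN hnN hθ0 hθ1 hR hp h1 h2 h3
    r K hK0 hK hr hy₁ hy₂
  refine ⟨C, hC, ?_⟩
  have hm : (H.numEdges : ℝ) = H.density * n.choose k := by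
    rw [density, Fintype.card_fin, div_mul_cancel₀ _ hchoose0.ne']
  rw [hCcard, hm]
  push_cast
  exact hrK

end UniformHypergraph

theorem theorem5 (k : ℕ) (hk : 2 ≤ k)
    (n : ℕ → ℕ) (hn : Tendsto n atTop atTop) (hdvd : ∀ i, k ∣ n i)
    (H : ∀ i, UniformHypergraph (Fin (n i)) k) (ε : ℕ → ℝ)
    (hR : ∀ i, (H i).IsPseudoRandom (ε i))
    (hε_one : MuchGreater (fun _ => 1) ε)
    (hε : MuchGreater ε (fun i =>
      Real.log (n i : ℝ) ^ 5 / ((n i : ℝ) ^ (1 / 2 : ℝ) * (H i).density ^ 2))) :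
    ∀ᶠ i in atTop, ∃ C : Finset (Finset (Finset (Fin (n i)))),
      (H i).IsPerfectMatchingPacking C ∧
      (1 - 4 * ε i ^ (1 / 3 : ℝ)) * ((H i).numEdges : ℝ) / ((n i : ℝ) / (k : ℝ)) ≤
        (C.card : ℝ) := by
  have hlog : Tendsto (fun i => Real.log (n i)) atTop atTop :=
    Real.tendsto_log_atTop.comp (tendsto_natCast_atTop_atTop.comp hn)
  -- Here `884736 = 192 ^ 3 / 8`, so that `ε = 8 * θ ^ 3` gives `θ ≤ 1 / 192`.
  filter_upwards [hε_one.eventually_ge_atTop 884736, hε.eventually_ge_atTop 1,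
    hlog.eventually_ge_atTop (64000 * (k : ℝ) ^ 3), hn.eventually_gt_atTop 0]
    with i h1 h2 hL hn0
  have hk' : (2 : ℝ) ≤ k := by exact_mod_cast hk
  have hn' : (0 : ℝ) < n i := by exact_mod_cast hn0
  have hε0 : 0 < ε i := one_div_pos.1 (lt_of_lt_of_le (by norm_num) h1)
  have hεle : ε i ≤ 1 / 884736 := by
    rw [le_div_iff₀ hε0] at h1
    rw [le_div_iff₀ (by norm_num)]
    linarith
  obtain ⟨N, hN⟩ := hdvd i
  have hN0 : 0 < N := by
    rcases Nat.eq_zero_or_pos N with h | h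
    · rw [hN, h] at hn0
      simp at hn0
    · exact h
  obtain ⟨L, hLdef⟩ : ∃ L, L = Real.log (n i) := ⟨_, rfl⟩
  rw [← hLdef] at h2 hL
  have hkk : (k : ℝ) ≤ (k : ℝ) ^ 3 := le_self_pow₀ (by linarith) (by norm_num)
  have hL1 : 1 ≤ L := by linarith
  -- If the density were zero, both divisions by zero would return `0`, against the lower bound 1
  -- for the ratio.
  have hp : 0 < (H i).density := by
    refine lt_of_le_of_ne (H i).density_nonneg fun h => ?_
    rw [← h] at h2
    norm_num at h2
  have hden : 0 < (n i : ℝ) ^ (1 / 2 : ℝ) * (H i).density ^ 2 := by positivity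
  have h3 : L ^ 5 ≤ ε i * ((n i : ℝ) ^ (1 / 2 : ℝ) * (H i).density ^ 2) := by
    rw [one_le_div (by positivity), div_le_iff₀ hden] at h2
    exact h2
  -- With this choice the loss `8 * θ` is exactly `4 * ε ^ (1 / 3)`.
  obtain ⟨θ, hθ⟩ : ∃ θ : ℝ, θ = ε i ^ (1 / 3 : ℝ) / 2 := ⟨_, rfl⟩
  have hθ0 : 0 < θ := by rw [hθ]; positivity
  have hθ3 : 8 * θ ^ 3 = ε i := by
    have : (ε i ^ (1 / 3 : ℝ)) ^ 3 = ε i := by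
      rw [← Real.rpow_natCast, ← Real.rpow_mul hε0.le]
      norm_num
    rw [hθ, div_pow, this]
    ring
  have hθ1 : θ ≤ 1 / 192 := by
    refine le_of_pow_le_pow_left₀ (n := 3) (by norm_num) (by norm_num) ?_
    norm_num
    linarith
  -- Squaring the lower bound on `ε` gives `L ^ 10 ≤ 64 * θ ^ 6 * p ^ 4 * n`, and `L ^ 10` exceeds
  -- the required multiple of `L ^ 2` because `L ≥ 64000 * k ^ 3`.
  have hZ : 1000 * (k : ℝ) ^ 3 * L ^ 2 ≤ θ ^ 6 * (H i).density ^ 4 * n i := by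
    have hsqrt : ((n i : ℝ) ^ (1 / 2 : ℝ)) ^ 2 = n i := by
      rw [← Real.sqrt_eq_rpow, Real.sq_sqrt hn'.le]
    have h4 : (L ^ 5) ^ 2 ≤ 64 * (θ ^ 6 * (H i).density ^ 4 * n i) := by
      calc (L ^ 5) ^ 2 ≤ (ε i * ((n i : ℝ) ^ (1 / 2 : ℝ) * (H i).density ^ 2)) ^ 2 := by
            gcongr
        _ = ε i ^ 2 * (H i).density ^ 4 * ((n i : ℝ) ^ (1 / 2 : ℝ)) ^ 2 := by ring
        _ = _ := by rw [hsqrt, ← hθ3]; ring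
    have h5 : 64000 * (k : ℝ) ^ 3 * L ^ 2 ≤ (L ^ 5) ^ 2 := by
      calc 64000 * (k : ℝ) ^ 3 * L ^ 2 ≤ L * L ^ 2 := by gcongr
        _ = L ^ 3 := by ring
        _ ≤ L ^ 10 := pow_le_pow_right₀ hL1 (by norm_num)
        _ = _ := by ring
    linarith
  obtain ⟨C, hC, hcard⟩ := (H i).exists_packing_card_ge hk hN0 (by rw [hN, mul_comm]) hθ0 hθ1
    (by rw [hθ3]; exact hR i) hp (by rw [← hLdef]; linarith) (by rw [← hLdef]; exact hZ)
  refine ⟨C, hC, le_trans (le_of_eq ?_) hcard⟩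
  have hNk : (n i : ℝ) / k = N := by
    rw [hN, Nat.cast_mul, mul_div_cancel_left₀ _ (by positivity)]
  rw [hNk, hθ]
  ring
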